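/- Let $\zeta$ be a real number and $n\ge 1$. For $P\in\mathbb{Z}[T]$ let $H(P)$ be the maximum modulus of its coefficients. Let $w_n(\zeta)\in[-\infty,\infty]$ be the supremum of the real $w$ for which $0<|P(\zeta)|\le H(P)^{-w}$ has infinitely many solutions $P\in\mathbb{Z}[T]$ of degree at most $n$. For $1\le j\le n+1$ let $\lambda_{n,j}(\zeta)\in[-\infty,\infty]$ be the supremum of the real $\lambda$ for which there are arbitrarily large $X$ such that the system $$1\le |x|\le X,\qquad \max_{1\le i\le n}|\zeta^i x-y_i|\le X^{-\lambda}$$ has $j$ linearly independent solutions $(x,y_1,\dots,y_n)\in\mathbb{Z}^{n+1}$, and put $\lambda_n(\zeta)=\lambda_{n,1}(\zeta)$. A transcendental real $\zeta$ is a $U_m$-number if $m\ge 1$ is the smallest index with $w_m(\zeta)=\infty$. The joint spectrum is the set of sequences $\{(\lambda_n(\zeta))_{n\ge1}:\zeta\in\mathbb{R}\}$. **Theorem 4.1.** (i) Let $\zeta$ be a $U_2$-number with $w_1(\zeta)=w\in[1,\infty)$. Then $$\lambda_n(\zeta)=\frac{w+1-n}{n}\quad\text{for }1\le n\le\frac{w+1}{2},\qquad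 \lambda_n(\zeta)=\lambda_{n,2}(\zeta)=1\quad\text{for }n\ge\frac{w+1}{2}.$$ In particular, if $w=1$ then $\lambda_n(\zeta)=1$ for all $n\ge1$. (ii) For $w\in[1,\infty)$ and $N=\lfloor\frac{w+1}{2}\rfloor$ consider the sequence $$\Big(w,\frac{w-1}{2},\frac{w-2}{3},\dots,\frac{w+1-N}{N},1,1,1,\dots\Big).\qquad(*)$$ The sequences $(*)$ with $w\in[1,\infty)$ are exactly the sequences $(\lambda_n(\zeta))_{n\ge1}$ of the $U_2$-numbers $\zeta$. In particular they all belong to the joint spectrum. (iii) The sequences $(*)$ with $w\in[1,\infty)$ together with the constant sequence $(\infty,\infty,\dots)$ are precisely the sequences in the joint spectrum with $\lambda_n(\zeta)>\frac12$ for all $n\ge1$. The same is true if in the definition of the joint spectrum only transcendental $\zeta$ are admitted. -/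

import Mathlib

noncomputable section

namespace DiophExp

open Polynomial Filter

/-- The (naive) height `H(P)`: the maximum modulus of the coefficients of `P`. -/
def height (P : ℤ[X]) : ℝ := P.supNorm

/-- `w_n(ζ)`: the supremum in `[-∞, ∞]` of the real `w` such that `0 < |P(ζ)| ≤ H(P)^{-w}` has
infinitely many solutions `P ∈ ℤ[T]` of degree at most `n`. -/
def wExp (n : ℕ) (ζ : ℝ) : EReal :=
  sSup ((fun w : ℝ => (w : EReal)) '' {w : ℝ | {P : ℤ[X] | P.natDegree ≤ n ∧
    0 < |aeval ζ P| ∧ |aeval ζ P| ≤ height P ^ (-w)}.Infinite})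

/-- The integer vector `v = (x, y_1, …, y_n)` solves
`1 ≤ |x| ≤ X`, `max_{1 ≤ i ≤ n} |ζ^i x - y_i| ≤ X^{-l}`. -/
def SimSol (n : ℕ) (ζ l X : ℝ) (v : Fin (n + 1) → ℤ) : Prop :=
  1 ≤ |v 0| ∧ (|v 0| : ℝ) ≤ X ∧
    ∀ i : Fin n, |ζ ^ ((i : ℕ) + 1) * (v 0 : ℝ) - (v i.succ : ℝ)| ≤ X ^ (-l)

/-- `λ_n(ζ)`: the supremum in `[-∞, ∞]` of the real `l` such that the system `SimSol` has an
integer solution for arbitrarily large `X`. -/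
def lambdaExp (n : ℕ) (ζ : ℝ) : EReal :=
  sSup ((fun l : ℝ => (l : EReal)) ''
    {l : ℝ | ∃ᶠ X : ℝ in atTop, ∃ v : Fin (n + 1) → ℤ, SimSol n ζ l X v})

/-- `λ_{n,j}(ζ)`: the same supremum, where `j` linearly independent integer solutions are
required for arbitrarily large `X`. -/
def lambdaExpMin (n j : ℕ) (ζ : ℝ) : EReal :=
  sSup ((fun l : ℝ => (l : EReal)) ''
    {l : ℝ | ∃ᶠ X : ℝ in atTop, ∃ v : Fin j → Fin (n + 1) → ℤ,
      LinearIndependent ℤ v ∧ ∀ k, SimSol n ζ l X (v k)})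

/-- `ζ` is a `U_m`-number: it is transcendental and `m ≥ 1` is the smallest index with
`w_m(ζ) = ∞`. -/
def IsUNumber (m : ℕ) (ζ : ℝ) : Prop :=
  Transcendental ℚ ζ ∧ 1 ≤ m ∧ wExp m ζ = ⊤ ∧ ∀ k, 1 ≤ k → k < m → wExp k ζ ≠ ⊤

/-- The sequence `(λ_n(ζ))_{n ≥ 1}`. -/
def lambdaSeq (ζ : ℝ) : ℕ+ → EReal := fun n => lambdaExp n ζ

/-- The joint spectrum of `(λ_n)_{n ≥ 1}`. -/
def jointSpectrum : Set (ℕ+ → EReal) := Set.range lambdaSeq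

/-- The sequence `(w, (w-1)/2, (w-2)/3, …, (w+1-N)/N, 1, 1, 1, …)` with `N = ⌊(w+1)/2⌋`. -/
def modelSeq (w : ℝ) : ℕ+ → EReal := fun n =>
  if (n : ℕ) ≤ ⌊(w + 1) / 2⌋₊ then (((w + 1 - (n : ℕ)) / (n : ℕ) : ℝ) : EReal) else 1

end DiophExp

end

/-!
# Exponents of simultaneous approximation of `U₂`-numbers

**Upper bounds.** If integers `y_0, …, y_n` satisfy `|ζ^i y_0 - y_i| ≤ X^{-l}` and `|y_0| ≤ X`,
column operations show that the `2 × 2` minors of the Hankel matrix `(y_{i+j})` are `O(X^{1-l})` and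
the `3 × 3` minors are `O(X^{1-2l})`. If `l > 1`, the `2 × 2` minors vanish for large `X`, so `y` is
geometric, `y_i = c q^{n-i} p^i`, and `p / q` is a very good rational approximation to `ζ`
(`le_wExp_one_of_lt_lambdaExp`). Hence `λ_n ≤ max (1, (w_1 + 1 - n) / n)` for irrational `ζ`.

**Lower bounds.** The powers `(q^n, q^{n-1} p, …, p^n)` of rational approximations give
`λ_n ≥ (w_1 + 1 - n) / n` (`le_lambdaExp_of_wExp_one_eq`). If `w_2 = ∞` and `w_1 < ∞`, there are
integer polynomials `P` of degree two which are extremely small at `ζ` in terms of their height. The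
relation `P(ζ) ≈ 0` expresses every power of `ζ` through `1` and `ζ` with coefficients bounded by a
power of the height, so each good rational approximation to `ζ` extends to an approximation of
`ζ, …, ζ^n` of almost the same quality. As `P` has no rational root near `ζ`, the number `ζ` is badly
approximable in the relevant range, and Dirichlet's theorem applied twice gives two independent
approximations: `λ_{n,2} ≥ 1` (`one_le_lambdaExpMin_two`).

**Exponents above `1/2`.** If `λ_n > 1/2`, the `3 × 3` Hankel minors vanish and `y` satisfies a
recurrence given by a primitive `P` of degree at most two. The powers with exponent `n - 2` of the
outer coefficients of `P` divide `2 × 2` minors (`exists_hankelTwo_eq_pow_mul`), so the height of `P`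
is at most about `X^{1/(n-2)}`, while `|P(ζ)|` is at most about `X^{-1/2}`. Letting `n` grow gives `w_2 = ∞`
unless `ζ` is a root of such a `P` (`wExp_two_eq_top_of_half_lt`). Liouville's inequality excludes
algebraic numbers with `w_2 = ∞`, so only rational numbers, Liouville numbers, quadratic numbers and
`U₂`-numbers remain, and their exponents are known by the first two parts.

**Existence.** A `U₂`-number with `w_1 = w` is given by a continued fraction whose partial quotients
are `1` except for sparse ones of size about `q^{w-1}`, where `q` is the preceding denominator. The
large partial quotients give `w_1 = w`, and the long blocks of ones bring `ζ` extremely close to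
quadratic irrationals with eventually constant partial quotients, so that `w_2 = ∞`
(`exists_isUNumber_two`).
-/

noncomputable section

namespace DiophExp

open Polynomial Filter

/-! ### Heights and the exponents `w_n` -/

lemma height_nonneg (P : ℤ[X]) : 0 ≤ height P := P.supNorm_nonneg

lemma abs_coeff_le_height (P : ℤ[X]) (i : ℕ) : |(P.coeff i : ℝ)| ≤ height P := by
  simpa [height, Int.norm_eq_abs] using P.le_supNorm i

lemma height_le_of_abs_coeff_le {P : ℤ[X]} {B : ℝ} (h : ∀ i, |(P.coeff i : ℝ)| ≤ B) :
    height P ≤ B := by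
  obtain ⟨i, hi⟩ := P.exists_eq_supNorm
  rw [height, hi, Int.norm_eq_abs]
  exact h i

lemma one_le_height {P : ℤ[X]} (hP : P ≠ 0) : 1 ≤ height P := by
  refine le_trans ?_ (abs_coeff_le_height P P.natDegree)
  have h : P.coeff P.natDegree ≠ 0 := by simpa using hP
  exact_mod_cast Int.one_le_abs h

lemma ne_zero_of_abs_aeval_pos {P : ℤ[X]} {ζ : ℝ} (h : 0 < |aeval ζ P|) : P ≠ 0 := by
  rintro rfl
  simp at h

lemma finite_natDegree_le_height_le (n : ℕ) (H : ℝ) :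
    {P : ℤ[X] | P.natDegree ≤ n ∧ height P ≤ H}.Finite := by
  have ht : (Set.univ.pi fun _ : Fin (n + 1) => Set.Icc (-⌈H⌉) ⌈H⌉).Finite :=
    Set.Finite.pi fun _ => Set.finite_Icc _ _
  refine Set.Finite.of_injOn (f := fun (P : ℤ[X]) (i : Fin (n + 1)) => P.coeff i) ?_ ?_ ht
  · rintro P ⟨-, hH⟩ i -
    rw [Set.mem_Icc, ← abs_le]
    have h := ((abs_coeff_le_height P i).trans hH).trans (Int.le_ceil H)
    exact_mod_cast h
  · rintro P ⟨hP, -⟩ Q ⟨hQ, -⟩ h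
    ext i
    by_cases hi : i < n + 1
    · exact congrFun h ⟨i, hi⟩
    · rw [coeff_eq_zero_of_natDegree_lt (by omega), coeff_eq_zero_of_natDegree_lt (by omega)]

lemma exists_pos_le_abs_aeval_of_finite (ζ : ℝ) {S : Set ℤ[X]} (hS : S.Finite) :
    ∃ ε > 0, ∀ P ∈ S, 0 < |aeval ζ P| → ε ≤ |aeval ζ P| := by
  induction S, hS using Set.Finite.induction_on with
  | empty => exact ⟨1, one_pos, by simp⟩
  | @insert Q S _ _ ih =>
    obtain ⟨ε, hε, h⟩ := ih
    by_cases hQ : 0 < |aeval ζ Q|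
    · refine ⟨min ε |aeval ζ Q|, lt_min hε hQ, ?_⟩
      rintro P (rfl | hP) h0
      · exact min_le_right _ _
      · exact (min_le_left _ _).trans (h P hP h0)
    · refine ⟨ε, hε, ?_⟩
      rintro P (rfl | hP) h0
      · exact absurd h0 hQ
      · exact h P hP h0

/-- Polynomials with arbitrarily small nonzero values are infinitely many, and a constant factor
does not affect the exponent. -/
lemma le_wExp_of_small {n : ℕ} {ζ w C : ℝ}
    (h : ∀ ε > 0, ∃ P : ℤ[X], P.natDegree ≤ n ∧ 0 < |aeval ζ P| ∧ |aeval ζ P| < ε ∧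
      |aeval ζ P| ≤ C * height P ^ (-w)) : (w : EReal) ≤ wExp n ζ := by
  by_contra! hlt
  obtain ⟨w', h1, h2⟩ := EReal.lt_iff_exists_real_btwn.1 hlt
  refine absurd h1 (not_lt.2 (le_sSup ⟨w', ?_, rfl⟩))
  have hw : 0 < w - w' := sub_pos.2 (EReal.coe_lt_coe_iff.1 h2)
  intro hfin
  obtain ⟨H₀, hH₀⟩ := eventually_atTop.1 ((tendsto_rpow_atTop hw).eventually_ge_atTop C)
  obtain ⟨ε, hε, hmin⟩ := exists_pos_le_abs_aeval_of_finite ζ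
    (hfin.union (finite_natDegree_le_height_le n H₀))
  obtain ⟨P, hP, h0, hPε, hle⟩ := h ε hε
  have hnot := fun hmem => not_lt.2 (hmin P hmem h0) hPε
  have hH : H₀ < height P := by
    by_contra! hcon
    exact hnot (Or.inr ⟨hP, hcon⟩)
  refine hnot (Or.inl ⟨hP, h0, hle.trans ?_⟩)
  have hpos : 0 < height P := one_pos.trans_le (one_le_height (ne_zero_of_abs_aeval_pos h0))
  calc C * height P ^ (-w) ≤ height P ^ (w - w') * height P ^ (-w) := by
        gcongr
        exact hH₀ _ hH.le
    _ = height P ^ (-w') := by rw [← Real.rpow_add hpos]; ring_nf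

/-- Below `w_n(ζ)` there are solutions of arbitrarily large height. -/
lemma exists_height_ge_of_lt_wExp {n : ℕ} {ζ w : ℝ} (h : (w : EReal) < wExp n ζ) (H₀ : ℝ) :
    ∃ P : ℤ[X], P.natDegree ≤ n ∧ H₀ ≤ height P ∧ 0 < |aeval ζ P| ∧
      |aeval ζ P| ≤ height P ^ (-w) := by
  obtain ⟨_, ⟨w', hw', rfl⟩, hlt⟩ := lt_sSup_iff.1 h
  have hww : w < w' := EReal.coe_lt_coe_iff.1 hlt
  obtain ⟨P, ⟨hP, h0, hle⟩, hnot⟩ :=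
    hw'.exists_notMem_finite (finite_natDegree_le_height_le n H₀)
  have hH : H₀ < height P := by
    by_contra! hcon
    exact hnot ⟨hP, hcon⟩
  refine ⟨P, hP, hH.le, h0, hle.trans ?_⟩
  exact Real.rpow_le_rpow_of_exponent_le (one_le_height (ne_zero_of_abs_aeval_pos h0))
    (by linarith)

lemma wExp_le_of_lower_bound {n : ℕ} {ζ w c : ℝ} (hc : 0 < c)
    (h : ∀ P : ℤ[X], P.natDegree ≤ n → 0 < |aeval ζ P| → c * height P ^ (-w) ≤ |aeval ζ P|) :
    wExp n ζ ≤ (w : EReal) := by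
  by_contra! hlt
  obtain ⟨w', h1, h2⟩ := EReal.lt_iff_exists_real_btwn.1 hlt
  have hw : 0 < w' - w := sub_pos.2 (EReal.coe_lt_coe_iff.1 h1)
  obtain ⟨H₀, hH₀⟩ := eventually_atTop.1 ((tendsto_rpow_atTop hw).eventually_gt_atTop c⁻¹)
  obtain ⟨P, hP, hH, h0, hle⟩ := exists_height_ge_of_lt_wExp h2 H₀
  have hpos : 0 < height P := one_pos.trans_le (one_le_height (ne_zero_of_abs_aeval_pos h0))
  have h3 := (h P hP h0).trans hle
  have h4 := hH₀ _ hH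
  have h5 : height P ^ (-w) = height P ^ (w' - w) * height P ^ (-w') := by
    rw [← Real.rpow_add hpos]; ring_nf
  have h6 : 0 < height P ^ (-w') := Real.rpow_pos_of_pos hpos _
  rw [h5, ← mul_assoc] at h3
  have h7 : c * height P ^ (w' - w) ≤ 1 := by
    by_contra! h8
    nlinarith
  have h8 : 1 < c * height P ^ (w' - w) := by
    calc (1 : ℝ) = c * c⁻¹ := (mul_inv_cancel₀ hc.ne').symm
      _ < _ := by gcongr
  linarith

lemma exists_lower_bound_of_wExp_lt {n : ℕ} {ζ w : ℝ} (h : wExp n ζ < (w : EReal)) :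
    ∃ c > 0, ∀ P : ℤ[X], P.natDegree ≤ n → 0 < |aeval ζ P| →
      c * height P ^ (-w) ≤ |aeval ζ P| := by
  have hfin : {P : ℤ[X] | P.natDegree ≤ n ∧ 0 < |aeval ζ P| ∧
      |aeval ζ P| ≤ height P ^ (-w)}.Finite := by
    by_contra hinf
    exact absurd h (not_lt.2 (le_sSup ⟨w, hinf, rfl⟩))
  obtain ⟨ε, hε, hmin⟩ := exists_pos_le_abs_aeval_of_finite ζ hfin
  obtain ⟨B, hB⟩ := (hfin.image fun P => height P ^ (-w)).bddAbove
  have hB1 : 0 < max B 1 := lt_max_of_lt_right one_pos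
  refine ⟨min 1 (ε / max B 1), lt_min one_pos (by positivity), fun P hP h0 => ?_⟩
  have hpos : 0 ≤ height P ^ (-w) := Real.rpow_nonneg (height_nonneg P) _
  by_cases hle : |aeval ζ P| ≤ height P ^ (-w)
  · have h1 : height P ^ (-w) ≤ max B 1 :=
      (hB ⟨P, ⟨hP, h0, hle⟩, rfl⟩).trans (le_max_left _ _)
    calc min 1 (ε / max B 1) * height P ^ (-w) ≤ ε / max B 1 * max B 1 := by
          gcongr
          exact min_le_right _ _
      _ = ε := by field_simp
      _ ≤ _ := hmin P ⟨hP, h0, hle⟩ h0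
  · calc min 1 (ε / max B 1) * height P ^ (-w) ≤ 1 * height P ^ (-w) := by
          gcongr
          exact min_le_left _ _
      _ ≤ _ := by linarith

/-- The linear polynomial `q T - p`. -/
def linPoly (q p : ℤ) : ℤ[X] := C q * X - C p

lemma aeval_linPoly (q p : ℤ) (ζ : ℝ) : aeval ζ (linPoly q p) = q * ζ - p := by
  simp [linPoly]

lemma natDegree_linPoly_le (q p : ℤ) : (linPoly q p).natDegree ≤ 1 := by
  unfold linPoly; compute_degree

lemma height_linPoly_le {q p : ℤ} {B : ℝ} (hq : |(q : ℝ)| ≤ B) (hp : |(p : ℝ)| ≤ B) :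
    height (linPoly q p) ≤ B := by
  refine height_le_of_abs_coeff_le fun i => ?_
  rcases i with _ | _ | i
  · simpa [linPoly, -eq_intCast] using hp
  · simpa [linPoly, coeff_C, -eq_intCast] using hq
  · rw [coeff_eq_zero_of_natDegree_lt (lt_of_le_of_lt (natDegree_linPoly_le q p) (by omega))]
    simpa using (abs_nonneg _).trans hq

lemma eq_linPoly_of_natDegree_le_one {P : ℤ[X]} (hP : P.natDegree ≤ 1) :
    P = linPoly (P.coeff 1) (-P.coeff 0) := by
  conv_lhs => rw [eq_X_add_C_of_natDegree_le_one hP]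
  simp [linPoly]

/-- The quadratic polynomial `a T² + b T + c`. -/
def quadPoly (a b c : ℤ) : ℤ[X] := C a * X ^ 2 + C b * X + C c

lemma aeval_quadPoly (a b c : ℤ) (ζ : ℝ) :
    aeval ζ (quadPoly a b c) = a * ζ ^ 2 + b * ζ + c := by
  simp [quadPoly]

lemma natDegree_quadPoly_le (a b c : ℤ) : (quadPoly a b c).natDegree ≤ 2 := by
  unfold quadPoly; compute_degree

lemma coeff_zero_quadPoly (a b c : ℤ) : (quadPoly a b c).coeff 0 = c := by
  simp [quadPoly, -eq_intCast]

lemma coeff_one_quadPoly (a b c : ℤ) : (quadPoly a b c).coeff 1 = b := by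
  simp [quadPoly, -eq_intCast]

lemma coeff_two_quadPoly (a b c : ℤ) : (quadPoly a b c).coeff 2 = a := by
  simp [quadPoly, -eq_intCast]

lemma height_quadPoly_le {a b c : ℤ} {B : ℝ} (ha : |(a : ℝ)| ≤ B) (hb : |(b : ℝ)| ≤ B)
    (hc : |(c : ℝ)| ≤ B) : height (quadPoly a b c) ≤ B := by
  refine height_le_of_abs_coeff_le fun i => ?_
  rcases i with _ | _ | _ | i
  · rwa [coeff_zero_quadPoly]
  · rwa [zero_add, coeff_one_quadPoly]
  · rwa [coeff_two_quadPoly]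
  · rw [coeff_eq_zero_of_natDegree_lt (lt_of_le_of_lt (natDegree_quadPoly_le a b c) (by omega))]
    simpa using (abs_nonneg _).trans ha

lemma eq_quadPoly_of_natDegree_le_two {P : ℤ[X]} (hP : P.natDegree ≤ 2) :
    P = quadPoly (P.coeff 2) (P.coeff 1) (P.coeff 0) := by
  ext i
  rcases i with _ | _ | _ | i
  · rw [coeff_zero_quadPoly]
  · rw [zero_add, coeff_one_quadPoly]
  · rw [coeff_two_quadPoly]
  · rw [coeff_eq_zero_of_natDegree_lt (by omega), coeff_eq_zero_of_natDegree_lt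
      (lt_of_le_of_lt (natDegree_quadPoly_le _ _ _) (by omega))]

/-- A linear form `q ζ - p` that is small against the power `q^{-s}` is small against the same
power of the height of `q T - p`, up to a constant depending on `ζ` and `s`. -/
lemma abs_linPoly_le {ζ s K : ℝ} {q p : ℤ} (hs : 0 ≤ s) (hq : 0 < q) (hK : 0 ≤ K)
    (h1 : |q * ζ - p| ≤ 1) (h : |q * ζ - p| ≤ K * (q : ℝ) ^ (-s)) :
    |aeval ζ (linPoly q p)| ≤ K * (|ζ| + 1) ^ s * height (linPoly q p) ^ (-s) := by
  have hq1 : (1 : ℝ) ≤ q := by exact_mod_cast hq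
  have hq0 : (0 : ℝ) < q := by linarith
  have hB : 0 < |ζ| + 1 := by positivity
  have hne : linPoly q p ≠ 0 := by
    intro h0
    have := congrArg (fun P => coeff P 1) h0
    simp only [linPoly, coeff_sub, coeff_C_mul, coeff_X_one, coeff_C_succ, coeff_zero] at this
    omega
  have hH : height (linPoly q p) ≤ (|ζ| + 1) * q := by
    refine height_linPoly_le ?_ ?_
    · rw [abs_of_pos hq0]; nlinarith [abs_nonneg ζ]
    · calc |(p : ℝ)| = |q * ζ - (q * ζ - p)| := by ring_nf
        _ ≤ |q * ζ| + |q * ζ - p| := abs_sub _ _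
        _ ≤ q * |ζ| + 1 := by rw [abs_mul, abs_of_pos hq0]; linarith
        _ ≤ _ := by nlinarith
  have hH0 : 0 < height (linPoly q p) := one_pos.trans_le (one_le_height hne)
  rw [aeval_linPoly]
  refine h.trans ?_
  rw [mul_assoc]
  gcongr
  rw [Real.rpow_neg hq0.le, Real.rpow_neg hH0.le, ← div_eq_mul_inv, inv_eq_one_div,
    div_le_div_iff₀ (by positivity) (by positivity), one_mul, ← Real.mul_rpow hB.le hq0.le]
  exact Real.rpow_le_rpow hH0.le hH hs

lemma abs_mul_sub_pos {ζ : ℝ} (hζ : Irrational ζ) {q : ℤ} (hq : q ≠ 0) (p : ℤ) :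
    0 < |q * ζ - p| := by
  rw [abs_pos]
  exact ((hζ.intCast_mul hq).sub_intCast p).ne_zero

/-- Dirichlet's theorem, with a reduced fraction. -/
lemma exists_coprime_abs_mul_sub_le (ζ : ℝ) {N : ℕ} (hN : 0 < N) :
    ∃ q p : ℤ, 0 < q ∧ q ≤ N ∧ IsCoprime q p ∧ |q * ζ - p| ≤ 1 / (N + 1) := by
  obtain ⟨r, hr, hden⟩ := Real.exists_rat_abs_sub_le_and_den_le ζ hN
  have hpos : (0 : ℝ) < r.den := by exact_mod_cast r.pos
  refine ⟨r.den, r.num, by exact_mod_cast r.pos, by exact_mod_cast hden, ?_, ?_⟩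
  · exact (Int.isCoprime_iff_nat_coprime.2 (by simpa using r.reduced)).symm
  · have h1 : (((r.den : ℤ) : ℝ) * ζ - (r.num : ℝ)) = r.den * (ζ - r) := by
      rw [mul_sub]
      have : (r.den : ℝ) * (r : ℝ) = r.num := by exact_mod_cast Rat.den_mul_eq_num r
      rw [this]; simp
    rw [h1, abs_mul, abs_of_pos hpos]
    calc (r.den : ℝ) * |ζ - r| ≤ r.den * (1 / ((N + 1) * r.den)) := by gcongr
      _ = _ := by field_simp

lemma one_le_wExp_one {ζ : ℝ} (hζ : Irrational ζ) : ((1 : ℝ) : EReal) ≤ wExp 1 ζ := by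
  refine le_wExp_of_small (C := (|ζ| + 1) ^ (1 : ℝ)) fun ε hε => ?_
  obtain ⟨N, hN⟩ := exists_nat_gt (max 1 (1 / ε))
  have hN1 : (1 : ℝ) < N := (le_max_left _ _).trans_lt hN
  have hN0 : 0 < N := by exact_mod_cast one_pos.trans hN1
  obtain ⟨q, p, hq, hqN, -, hle⟩ := exists_coprime_abs_mul_sub_le ζ hN0
  have hq0 : (0 : ℝ) < q := by exact_mod_cast hq
  have hqN' : (q : ℝ) ≤ N := by exact_mod_cast hqN
  have hε' : 1 / ((N : ℝ) + 1) < ε := by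
    rw [div_lt_comm₀ (by positivity) hε]
    linarith [(le_max_right 1 (1 / ε)).trans_lt hN]
  refine ⟨linPoly q p, natDegree_linPoly_le q p, ?_, ?_, ?_⟩
  · rw [aeval_linPoly]; exact abs_mul_sub_pos hζ hq.ne' p
  · rw [aeval_linPoly]; exact hle.trans_lt hε'
  · have := abs_linPoly_le (ζ := ζ) (s := 1) (K := 1) (q := q) (p := p) zero_le_one hq zero_le_one
      (hle.trans (by rw [div_le_one (by positivity)]; linarith))
      (hle.trans (by
        rw [one_mul, Real.rpow_neg_one, one_div]
        gcongr; linarith))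
    simpa using this

/-! ### The exponents `λ_n` -/

lemma lambdaExpMin_two_le (n : ℕ) (ζ : ℝ) : lambdaExpMin n 2 ζ ≤ lambdaExp n ζ :=
  sSup_le_sSup (Set.image_mono fun _ h => h.mono fun _ ⟨v, _, hv⟩ => ⟨v 0, hv 0⟩)

/-- `y` consists of the numerators of a simultaneous approximation to `ζ, …, ζ^n` with
denominator `y 0`, indexed by `ℕ` so that shifts of indices are convenient. -/
def IsApprox (n : ℕ) (ζ δ X : ℝ) (y : ℕ → ℤ) : Prop :=
  y 0 ≠ 0 ∧ |(y 0 : ℝ)| ≤ X ∧ ∀ i ≤ n, |ζ ^ i * y 0 - y i| ≤ δ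

lemma IsApprox.simSol {n : ℕ} {ζ l X : ℝ} {y : ℕ → ℤ} (h : IsApprox n ζ (X ^ (-l)) X y) :
    SimSol n ζ l X fun i => y i :=
  ⟨Int.one_le_abs h.1, h.2.1, fun i => by simpa using h.2.2 (i + 1) (by omega)⟩

lemma SimSol.exists_isApprox {n : ℕ} {ζ l X : ℝ} {v : Fin (n + 1) → ℤ} (hX : 0 ≤ X)
    (h : SimSol n ζ l X v) : ∃ y, IsApprox n ζ (X ^ (-l)) X y := by
  refine ⟨fun i => if hi : i < n + 1 then v ⟨i, hi⟩ else 0, ?_, ?_, ?_⟩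
  · have := h.1
    simp only [Nat.zero_lt_succ, dite_true, Fin.mk_zero]
    intro h0
    rw [h0] at this
    norm_num at this
  · simpa using h.2.1
  · rintro (_ | i) hi
    · simpa using Real.rpow_nonneg hX _
    · have := h.2.2 ⟨i, by omega⟩
      simpa [show i < n by omega] using this

lemma IsApprox.mono {n m : ℕ} {ζ δ X : ℝ} {y : ℕ → ℤ} (h : IsApprox n ζ δ X y) (hm : m ≤ n) :
    IsApprox m ζ δ X y :=
  ⟨h.1, h.2.1, fun i hi => h.2.2 i (hi.trans hm)⟩

lemma exists_isApprox_of_lt {n : ℕ} {ζ l : ℝ} (h : (l : EReal) < lambdaExp n ζ) (X₀ : ℝ) :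
    ∃ X ≥ X₀, 1 ≤ X ∧ ∃ y, IsApprox n ζ (X ^ (-l)) X y := by
  obtain ⟨_, ⟨l', hl', rfl⟩, hlt⟩ := lt_sSup_iff.1 h
  have hll : l < l' := EReal.coe_lt_coe_iff.1 hlt
  obtain ⟨X, hX, v, hv⟩ := frequently_atTop.1 hl' (max X₀ 1)
  have hX1 : 1 ≤ X := (le_max_right _ _).trans hX
  obtain ⟨y, h0, h1, h2⟩ := hv.exists_isApprox (zero_le_one.trans hX1)
  exact ⟨X, (le_max_left _ _).trans hX, hX1, y, h0, h1, fun i hi => (h2 i hi).trans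
    (Real.rpow_le_rpow_of_exponent_le hX1 (by linarith))⟩

lemma le_lambdaExp_of_isApprox {n : ℕ} {ζ l C : ℝ}
    (h : ∀ X₀ : ℝ, ∃ X ≥ X₀, ∃ y, IsApprox n ζ (C * X ^ (-l)) X y) :
    (l : EReal) ≤ lambdaExp n ζ := by
  by_contra! hlt
  obtain ⟨l', h1, h2⟩ := EReal.lt_iff_exists_real_btwn.1 hlt
  refine absurd h1 (not_lt.2 (le_sSup ⟨l', ?_, rfl⟩))
  have hl : 0 < l - l' := sub_pos.2 (EReal.coe_lt_coe_iff.1 h2)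
  obtain ⟨X₁, hX₁⟩ := eventually_atTop.1 ((tendsto_rpow_atTop hl).eventually_ge_atTop C)
  refine frequently_atTop.2 fun X₀ => ?_
  obtain ⟨X, hX, y, hy⟩ := h (max (max X₀ 1) X₁)
  have hX0 : 0 < X := one_pos.trans_le ((le_max_right _ _).trans ((le_max_left _ _).trans hX))
  refine ⟨X, (le_max_left _ _).trans ((le_max_left _ _).trans hX), fun i => y i,
    IsApprox.simSol ⟨hy.1, hy.2.1, fun i hi => (hy.2.2 i hi).trans ?_⟩⟩
  calc C * X ^ (-l) ≤ X ^ (l - l') * X ^ (-l) := by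
        gcongr
        exact hX₁ _ ((le_max_right _ _).trans hX)
    _ = X ^ (-l') := by rw [← Real.rpow_add hX0]; ring_nf

/-- The powers of a rational number are approximated without error by a fixed vector. -/
lemma lambdaExp_eq_top_of_not_irrational {ζ : ℝ} (hζ : ¬ Irrational ζ) (n : ℕ) :
    lambdaExp n ζ = ⊤ := by
  rw [Irrational, not_not] at hζ
  obtain ⟨r, rfl⟩ := hζ
  rw [EReal.eq_top_iff_forall_lt]
  intro l
  refine lt_of_lt_of_le (EReal.coe_lt_coe_iff.2 (lt_add_one l))
    (le_lambdaExp_of_isApprox (C := 1) fun X₀ => ?_)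
  have hden : (r.den : ℝ) ≠ 0 := by exact_mod_cast r.den_nz
  refine ⟨max X₀ ((r.den : ℝ) ^ n), le_max_left _ _, fun i => r.den ^ (n - i) * r.num ^ i,
    by simp, by simp, fun i hi => ?_⟩
  have h1 : ((r : ℝ)) * r.den = r.num := by exact_mod_cast Rat.mul_den_eq_num r
  have h2 : (r : ℝ) ^ i * (((r.den : ℤ) ^ (n - 0) * r.num ^ 0 : ℤ) : ℝ)
      - (((r.den : ℤ) ^ (n - i) * r.num ^ i : ℤ) : ℝ) = 0 := by
    push_cast
    rw [← h1, mul_pow, Nat.sub_zero, show (r.den : ℝ) ^ n = r.den ^ (n - i) * r.den ^ i by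
      rw [← pow_add, Nat.sub_add_cancel hi]]
    ring
  rw [h2, abs_zero, one_mul]
  exact Real.rpow_nonneg (le_max_of_le_right (by positivity)) _

/-- The powers `(q^n, q^{n-1} p, …, p^n)` of a good rational approximation `p / q` to `ζ` give
simultaneous approximations to `ζ, …, ζ^n`. -/
lemma le_lambdaExp_of_lt_wExp_one {ζ w : ℝ} {n : ℕ} (hn : 1 ≤ n) (hw : 0 ≤ w)
    (h : (w : EReal) < wExp 1 ζ) : (((w + 1 - n) / n : ℝ) : EReal) ≤ lambdaExp n ζ := by
  set Z := max 1 |ζ| with hZ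
  have hZ1 : 1 ≤ Z := le_max_left _ _
  have hζZ : |ζ| ≤ Z := le_max_right _ _
  refine le_lambdaExp_of_isApprox (C := n * Z ^ n) fun X₀ => ?_
  obtain ⟨P, hP, hH, h0, hle⟩ := exists_height_ge_of_lt_wExp h (max 2 X₀)
  have hH2 : 2 ≤ height P := (le_max_left _ _).trans hH
  have hH0 : 0 < height P := by linarith
  have hHn : height P ≤ height P ^ n := le_self_pow₀ (by linarith) (by omega)
  set q := P.coeff 1 with hq
  set p := -P.coeff 0 with hp
  have hPl : P = linPoly q p := eq_linPoly_of_natDegree_le_one hP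
  have hqH : |(q : ℝ)| ≤ height P := abs_coeff_le_height P 1
  have hpH : |(p : ℝ)| ≤ height P := by simpa [hp] using abs_coeff_le_height P 0
  have hval : |q * ζ - p| ≤ height P ^ (-w) := by rwa [← aeval_linPoly, ← hPl]
  have hq0 : q ≠ 0 := by
    intro hq0
    rw [hq0] at hval
    have h1 : |(p : ℝ)| ≤ 1 := by
      simpa using hval.trans (Real.rpow_le_one_of_one_le_of_nonpos (by linarith) (by linarith))
    have h2 := height_linPoly_le (q := q) (p := p) (B := 1) (by simp [hq0]) h1
    rw [← hPl] at h2
    linarith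
  refine ⟨height P ^ n, ((le_max_right _ _).trans hH).trans hHn, fun i => q ^ (n - i) * p ^ i,
    by simpa using pow_ne_zero n hq0, ?_, ?_⟩
  · simpa using pow_le_pow_left₀ (abs_nonneg _) hqH n
  intro i hi
  have hpow : (height P ^ n) ^ (-((w + 1 - n) / n)) = height P ^ (n - 1) * height P ^ (-w) := by
    rw [← Real.rpow_natCast, ← Real.rpow_natCast, ← Real.rpow_mul hH0.le, ← Real.rpow_add hH0]
    congr 1
    have : (n : ℝ) ≠ 0 := by positivity
    field_simp
    push_cast [hn]
    ring
  rw [hpow]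
  rcases Nat.eq_zero_or_pos i with rfl | hi0
  · simp only [pow_zero, one_mul, Nat.sub_zero, mul_one, sub_self, abs_zero]
    positivity
  have hfac : ζ ^ i * ((q ^ (n - 0) * p ^ 0 : ℤ) : ℝ) - ((q ^ (n - i) * p ^ i : ℤ) : ℝ)
      = q ^ (n - i) * ((q * ζ) ^ i - p ^ i) := by
    push_cast
    rw [Nat.sub_zero, show (q : ℝ) ^ n = q ^ (n - i) * q ^ i by
      rw [← pow_add, Nat.sub_add_cancel hi], mul_pow]
    ring
  rw [hfac, abs_mul, abs_pow]
  have hmax : max |q * ζ| |(p : ℝ)| ≤ height P * Z := by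
    refine max_le ?_ ?_
    · rw [abs_mul]; gcongr
    · nlinarith
  have hin : (i : ℝ) ≤ n := by exact_mod_cast hi
  calc |(q : ℝ)| ^ (n - i) * |(q * ζ) ^ i - (p : ℝ) ^ i|
      ≤ |(q : ℝ)| ^ (n - i) * (|q * ζ - p| * i * max |q * ζ| |(p : ℝ)| ^ (i - 1)) := by
        gcongr
        exact abs_pow_sub_pow_le ..
    _ ≤ height P ^ (n - i) * (height P ^ (-w) * n * (height P * Z) ^ (i - 1)) := by gcongr
    _ = n * Z ^ (i - 1) * (height P ^ (n - i + (i - 1)) * height P ^ (-w)) := by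
        rw [pow_add, mul_pow]; ring
    _ ≤ n * Z ^ n * (height P ^ (n - 1) * height P ^ (-w)) := by
        rw [show n - i + (i - 1) = n - 1 by omega]
        have : Z ^ (i - 1) ≤ Z ^ n := pow_le_pow_right₀ hZ1 (by omega)
        gcongr

lemma lambdaExp_eq_top_of_wExp_one_eq_top {ζ : ℝ} (h : wExp 1 ζ = ⊤) {n : ℕ} (hn : 1 ≤ n) :
    lambdaExp n ζ = ⊤ := by
  rw [EReal.eq_top_iff_forall_lt]
  intro l
  have hn0 : (0 : ℝ) < n := by exact_mod_cast hn
  have hw : 0 ≤ n * (|l| + 1) + n - 1 := by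
    have : (1 : ℝ) ≤ n := by exact_mod_cast hn
    nlinarith [abs_nonneg l]
  refine lt_of_lt_of_le (EReal.coe_lt_coe_iff.2 ?_)
    (le_lambdaExp_of_lt_wExp_one hn hw (h ▸ EReal.coe_lt_top _))
  rw [lt_div_iff₀ hn0]
  nlinarith [le_abs_self l]

lemma le_lambdaExp_of_wExp_one_eq {ζ w : ℝ} (hw : 1 ≤ w) (h : wExp 1 ζ = (w : EReal)) {n : ℕ}
    (hn : 1 ≤ n) : (((w + 1 - n) / n : ℝ) : EReal) ≤ lambdaExp n ζ := by
  by_contra! hlt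
  obtain ⟨r, h1, h2⟩ := EReal.lt_iff_exists_real_btwn.1 hlt
  have hn0 : (0 : ℝ) < n := by exact_mod_cast hn
  have h3 : r < (w + 1 - n) / n := EReal.coe_lt_coe_iff.1 h2
  rw [lt_div_iff₀ hn0] at h3
  have h4 : max 0 (r * n + n - 1) < w := max_lt (by linarith) (by linarith)
  refine absurd h1 (not_lt.2 (le_trans (EReal.coe_le_coe_iff.2 ?_)
    (le_lambdaExp_of_lt_wExp_one hn (le_max_left _ _) (h ▸ EReal.coe_lt_coe_iff.2 h4))))
  rw [le_div_iff₀ hn0]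
  linarith [le_max_right 0 (r * n + n - 1)]

/-! ### Minors of the Hankel matrix of an approximation -/

namespace IsApprox

variable {n : ℕ} {ζ δ X Z : ℝ} {y : ℕ → ℤ}

lemma abs_shift_le (h : IsApprox n ζ δ X y) (hZ : 1 ≤ Z) (hζ : |ζ| ≤ Z) {i : ℕ} (hi : i + 1 ≤ n) :
    |(y (i + 1) : ℝ) - ζ * y i| ≤ 2 * Z * δ := by
  have h1 := h.2.2 i (by omega)
  have h2 := h.2.2 (i + 1) hi
  have hδ : 0 ≤ δ := (abs_nonneg _).trans h1
  calc |(y (i + 1) : ℝ) - ζ * y i|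
      = |ζ * (ζ ^ i * y 0 - y i) - (ζ ^ (i + 1) * y 0 - y (i + 1))| := by
        rw [pow_succ]; ring_nf
    _ ≤ |ζ| * |ζ ^ i * y 0 - y i| + |ζ ^ (i + 1) * y 0 - y (i + 1)| := by
        rw [← abs_mul]; exact abs_sub _ _
    _ ≤ Z * δ + δ := by gcongr
    _ ≤ 2 * Z * δ := by nlinarith

lemma abs_le (h : IsApprox n ζ δ X y) (hZ : 1 ≤ Z) (hζ : |ζ| ≤ Z) (hδ : δ ≤ 1) (hX : 1 ≤ X)
    {i : ℕ} (hi : i ≤ n) : |(y i : ℝ)| ≤ 2 * Z ^ n * X := by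
  have h1 := h.2.2 i hi
  have hZi : Z ^ i ≤ Z ^ n := pow_le_pow_right₀ hZ hi
  have hZn : 1 ≤ Z ^ n := one_le_pow₀ hZ
  calc |(y i : ℝ)| = |ζ ^ i * y 0 - (ζ ^ i * y 0 - y i)| := by ring_nf
    _ ≤ |ζ| ^ i * |(y 0 : ℝ)| + |ζ ^ i * y 0 - y i| := by
        rw [← abs_pow, ← abs_mul]; exact abs_sub _ _
    _ ≤ Z ^ n * X + 1 := by
        have : |ζ| ^ i ≤ Z ^ n := (pow_le_pow_left₀ (abs_nonneg _) hζ i).trans hZi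
        gcongr
        · exact h.2.1
        · linarith
    _ ≤ 2 * Z ^ n * X := by nlinarith

lemma abs_minor_two_le (h : IsApprox n ζ δ X y) (hZ : 1 ≤ Z) (hζ : |ζ| ≤ Z) (hδ : δ ≤ 1)
    (hX : 1 ≤ X) {i j : ℕ} (hi : i + 1 ≤ n) (hj : j + 1 ≤ n) :
    |((y i * y (j + 1) - y (i + 1) * y j : ℤ) : ℝ)| ≤ 8 * Z ^ (n + 1) * (X * δ) := by
  have hi1 := h.abs_shift_le hZ hζ hi
  have hj1 := h.abs_shift_le hZ hζ hj
  have hi2 := h.abs_le hZ hζ hδ hX (show i ≤ n by omega)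
  have hj2 := h.abs_le hZ hζ hδ hX (show j ≤ n by omega)
  have hδ0 : 0 ≤ δ := (abs_nonneg _).trans (h.2.2 0 (Nat.zero_le _))
  calc |((y i * y (j + 1) - y (i + 1) * y j : ℤ) : ℝ)|
      = |y i * (y (j + 1) - ζ * y j) - (y (i + 1) - ζ * y i) * (y j : ℝ)| := by
        push_cast; ring_nf
    _ ≤ |(y i : ℝ)| * |y (j + 1) - ζ * y j| + |y (i + 1) - ζ * y i| * |(y j : ℝ)| := by
        rw [← abs_mul, ← abs_mul]; exact abs_sub _ _
    _ ≤ 2 * Z ^ n * X * (2 * Z * δ) + 2 * Z * δ * (2 * Z ^ n * X) := by gcongr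
    _ = _ := by ring

end IsApprox

/-- An integer sequence in geometric progression with `n + 1` terms has the form
`c q^n, c q^{n-1} p, …`, so that its first term is divisible by the `n`-th power of the
denominator of the ratio. -/
lemma exists_eq_mul_pow_of_geometric {n : ℕ} (hn : 1 ≤ n) {y : ℕ → ℤ} (h0 : y 0 ≠ 0)
    (h : ∀ j < n, y 0 * y (j + 1) = y 1 * y j) :
    ∃ c q p : ℤ, c ≠ 0 ∧ 0 < q ∧ y 0 = c * q ^ n ∧ y 1 = c * q ^ (n - 1) * p := by
  obtain ⟨g, q, p, hg, hco, hq, hp⟩ : ∃ g q p : ℤ, g ≠ 0 ∧ IsCoprime q p ∧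
      y 0 = g * q ∧ y 1 = g * p := by
    refine ⟨(Int.gcd (y 0) (y 1) : ℤ), y 0 / Int.gcd (y 0) (y 1), y 1 / Int.gcd (y 0) (y 1),
      ?_, ?_, ?_, ?_⟩
    · exact_mod_cast (Int.gcd_pos_of_ne_zero_left _ h0).ne'
    · exact Int.isCoprime_iff_gcd_eq_one.2
        (Int.gcd_div_gcd_div_gcd (Int.gcd_pos_of_ne_zero_left _ h0))
    · exact (Int.mul_ediv_cancel' (Int.gcd_dvd_left ..)).symm
    · exact (Int.mul_ediv_cancel' (Int.gcd_dvd_right ..)).symm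
  have hq0 : q ≠ 0 := by rintro rfl; simp at hq; exact h0 hq
  have hstep : ∀ j < n, q * y (j + 1) = p * y j := by
    intro j hj
    have := h j hj
    rw [hq, hp, mul_assoc, mul_assoc] at this
    exact mul_left_cancel₀ hg this
  have hpow : ∀ j ≤ n, q ^ j * y j = p ^ j * y 0 := by
    intro j
    induction j with
    | zero => simp
    | succ j ih =>
      intro hj
      calc q ^ (j + 1) * y (j + 1) = q ^ j * (q * y (j + 1)) := by ring
        _ = p * (q ^ j * y j) := by rw [hstep j (by omega)]; ring
        _ = _ := by rw [ih (by omega)]; ring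
  obtain ⟨c, hc⟩ : q ^ n ∣ y 0 :=
    (hco.pow : IsCoprime (q ^ n) (p ^ n)).dvd_of_dvd_mul_left ⟨y n, (hpow n le_rfl).symm⟩
  have hc0 : c ≠ 0 := by rintro rfl; simp at hc; exact h0 hc
  have h1 : y 1 = c * q ^ (n - 1) * p := by
    have h2 := hstep 0 (by omega)
    apply mul_left_cancel₀ hq0
    rw [zero_add] at h2
    rw [h2, hc]
    obtain ⟨m, rfl⟩ : ∃ m, n = m + 1 := ⟨n - 1, by omega⟩
    rw [Nat.add_sub_cancel]; ring
  rcases hq0.lt_or_gt with hneg | hpos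
  · refine ⟨c * (-1) ^ n, -q, -p, mul_ne_zero hc0 (by simp), by omega, ?_, ?_⟩
    · rw [hc, mul_assoc, ← mul_pow]; ring_nf
    · rw [h1]
      obtain ⟨m, rfl⟩ : ∃ m, n = m + 1 := ⟨n - 1, by omega⟩
      rw [Nat.add_sub_cancel, neg_pow q m]
      have : ((-1 : ℤ) ^ m) * (-1) ^ m = 1 := by rw [← mul_pow]; simp
      linear_combination (-(c * q ^ m * p)) * this
  · exact ⟨c, q, p, hc0, hpos, by rw [hc]; ring, h1⟩

/-- The ratio of a geometric approximation is a very good rational approximation. -/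
lemma IsApprox.exists_linear_of_geometric {n : ℕ} {ζ δ X : ℝ} {y : ℕ → ℤ}
    (hy : IsApprox n ζ δ X y) (hn : 1 ≤ n) (h : ∀ j < n, y 0 * y (j + 1) = y 1 * y j) :
    ∃ q p : ℤ, 0 < q ∧ (q : ℝ) ^ n ≤ X ∧ (q : ℝ) ^ (n - 1) * |q * ζ - p| ≤ δ := by
  obtain ⟨c, q, p, hc, hq, h0, h1⟩ := exists_eq_mul_pow_of_geometric hn hy.1 h
  have hc1 : (1 : ℝ) ≤ |(c : ℝ)| := by exact_mod_cast Int.one_le_abs hc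
  have hq0 : (0 : ℝ) < q := by exact_mod_cast hq
  refine ⟨q, p, hq, ?_, ?_⟩
  · have h2 := hy.2.1
    rw [h0] at h2
    push_cast at h2
    rw [abs_mul, abs_of_pos (pow_pos hq0 n)] at h2
    nlinarith [pow_pos hq0 n]
  · have h2 := hy.2.2 1 hn
    have h3 : ζ ^ 1 * y 0 - y 1 = c * ((q : ℝ) ^ (n - 1) * (q * ζ - p)) := by
      rw [h0, h1]
      push_cast
      obtain ⟨m, rfl⟩ : ∃ m, n = m + 1 := ⟨n - 1, by omega⟩
      rw [Nat.add_sub_cancel]; ring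
    rw [h3, abs_mul, abs_mul, abs_of_pos (pow_pos hq0 _)] at h2
    nlinarith [mul_nonneg (pow_pos hq0 (n - 1)).le (abs_nonneg (q * ζ - p))]

/-- An approximation of quality `l > 1` is geometric, and therefore comes from a rational
approximation of `ζ`. -/
lemma le_wExp_one_of_lt_lambdaExp {ζ l : ℝ} (hζ : Irrational ζ) {n : ℕ} (hn : 1 ≤ n) (hl : 1 < l)
    (h : (l : EReal) < lambdaExp n ζ) : ((n * l + n - 1 : ℝ) : EReal) ≤ wExp 1 ζ := by
  have hn1 : (1 : ℝ) ≤ n := by exact_mod_cast hn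
  have hs : 0 ≤ n * l + n - 1 := by nlinarith
  set Z := max 1 |ζ|
  have hZ1 : 1 ≤ Z := le_max_left _ _
  have hζZ : |ζ| ≤ Z := le_max_right _ _
  refine le_wExp_of_small (C := 1 * (|ζ| + 1) ^ (n * l + n - 1)) fun ε hε => ?_
  have ht1 := tendsto_rpow_neg_atTop (show 0 < l by linarith)
  have ht2 := tendsto_rpow_neg_atTop (show 0 < l - 1 by linarith)
  obtain ⟨X₀, hX₀⟩ := eventually_atTop.1
    (((ht1.eventually_lt_const hε).and (ht1.eventually_lt_const one_pos)).and
      (ht2.eventually_lt_const (show 0 < 1 / (8 * Z ^ (n + 1)) by positivity)))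
  obtain ⟨X, hX, hX1, y, hy⟩ := exists_isApprox_of_lt h X₀
  obtain ⟨⟨hXε, hXone⟩, hXm⟩ := hX₀ X hX
  have hX0 : 0 < X := by linarith
  have hgeo : ∀ j < n, y 0 * y (j + 1) = y 1 * y j := by
    intro j hj
    have h1 := hy.abs_minor_two_le hZ1 hζZ hXone.le hX1 (i := 0) (j := j) hn hj
    have h2 : X * X ^ (-l) = X ^ (-(l - 1)) := by
      rw [← Real.rpow_one_add' hX0.le (by linarith)]; ring_nf
    rw [h2] at h1
    rw [lt_div_iff₀ (by positivity)] at hXm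
    have h3 : |((y 0 * y (j + 1) - y (0 + 1) * y j : ℤ) : ℝ)| < 1 := by linarith
    have h4 : |y 0 * y (j + 1) - y (0 + 1) * y j| < 1 := by exact_mod_cast h3
    rw [Int.abs_lt_one_iff, zero_add] at h4
    linarith
  obtain ⟨q, p, hq, hqX, hqp⟩ := hy.exists_linear_of_geometric hn hgeo
  have hq1 : (1 : ℝ) ≤ q := by exact_mod_cast hq
  have hq0 : (0 : ℝ) < q := by linarith
  have hle : |q * ζ - p| ≤ X ^ (-l) := by
    refine le_trans ?_ hqp
    exact le_mul_of_one_le_left (abs_nonneg _) (one_le_pow₀ hq1)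
  refine ⟨linPoly q p, natDegree_linPoly_le q p, ?_, ?_, ?_⟩
  · rw [aeval_linPoly]; exact abs_mul_sub_pos hζ hq.ne' p
  · rw [aeval_linPoly]; exact hle.trans_lt hXε
  · refine abs_linPoly_le hs hq zero_le_one (hle.trans hXone.le) ?_
    have h1 : X ^ (-l) ≤ ((q : ℝ) ^ n) ^ (-l) :=
      Real.rpow_le_rpow_of_nonpos (by positivity) hqX (by linarith)
    have h2 : (q : ℝ) ^ (n - 1) * |q * ζ - p| ≤ (q : ℝ) ^ (-(n * l)) := by
      refine hqp.trans (h1.trans (le_of_eq ?_))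
      rw [← Real.rpow_natCast, ← Real.rpow_mul hq0.le]; ring_nf
    have h3 : (q : ℝ) ^ (-(n * l)) = (q : ℝ) ^ (n - 1) * (q : ℝ) ^ (-(n * l + n - 1)) := by
      rw [← Real.rpow_natCast, ← Real.rpow_add hq0]
      congr 1
      push_cast [hn]
      ring
    rw [h3] at h2
    rw [one_mul]
    exact le_of_mul_le_mul_left h2 (by positivity)

lemma lambdaExp_le_of_wExp_one_eq {ζ w : ℝ} (hζ : Irrational ζ) (h : wExp 1 ζ = (w : EReal))
    {n : ℕ} (hn : 1 ≤ n) : lambdaExp n ζ ≤ ((max 1 ((w + 1 - n) / n) : ℝ) : EReal) := by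
  by_contra! hlt
  obtain ⟨l, h1, h2⟩ := EReal.lt_iff_exists_real_btwn.1 hlt
  have hn0 : (0 : ℝ) < n := by exact_mod_cast hn
  obtain ⟨h3, h4⟩ := max_lt_iff.1 (EReal.coe_lt_coe_iff.1 h1)
  have h5 := le_wExp_one_of_lt_lambdaExp hζ hn h3 h2
  rw [h, EReal.coe_le_coe_iff] at h5
  rw [div_lt_iff₀ hn0] at h4
  linarith

/-! ### Polynomial values at algebraic numbers -/

lemma norm_aeval_le {P : ℤ[X]} {n : ℕ} (hP : P.natDegree ≤ n) {A : ℝ} (hA : 1 ≤ A) {z : ℂ}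
    (hz : ‖z‖ ≤ A) : ‖aeval z P‖ ≤ (n + 1) * A ^ n * height P := by
  rw [aeval_eq_sum_range' (Nat.lt_succ_of_le hP)]
  calc ‖∑ i ∈ Finset.range (n + 1), P.coeff i • z ^ i‖
      ≤ ∑ i ∈ Finset.range (n + 1), ‖P.coeff i • z ^ i‖ := norm_sum_le _ _
    _ ≤ ∑ i ∈ Finset.range (n + 1), height P * A ^ n := by
        refine Finset.sum_le_sum fun i hi => ?_
        rw [zsmul_eq_mul, norm_mul, norm_pow, Complex.norm_intCast]
        have h1 : ‖z‖ ^ i ≤ A ^ n := (pow_le_pow_left₀ (norm_nonneg _) hz i).trans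
          (pow_le_pow_right₀ hA (by simpa [Nat.lt_succ_iff] using hi))
        gcongr
        · exact height_nonneg P
        · exact abs_coeff_le_height P i
    _ = _ := by simp; ring

lemma norm_multiset_prod_map_le {s : Multiset ℂ} {g : ℂ → ℂ} {B : ℝ} (hB : 0 ≤ B)
    (h : ∀ z ∈ s, ‖g z‖ ≤ B) : ‖(s.map g).prod‖ ≤ B ^ s.card := by
  induction s using Multiset.induction_on with
  | empty => simp
  | cons a s ih =>
    rw [Multiset.map_cons, Multiset.prod_cons, norm_mul, Multiset.card_cons, pow_succ']
    have h1 := h a (Multiset.mem_cons_self a s)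
    have h2 := ih fun z hz => h z (Multiset.mem_cons_of_mem hz)
    gcongr

/-- Liouville's inequality: a nonzero value at an algebraic number of an integer polynomial of
bounded degree is at least a negative power of the height. The resultant with the minimal
polynomial is a nonzero integer, and all its factors but one are bounded by the height. -/
lemma exists_lower_bound_of_isAlgebraic {ζ : ℝ} (hζ : IsAlgebraic ℚ ζ) (n : ℕ) :
    ∃ c > 0, ∃ d : ℕ, ∀ P : ℤ[X], P.natDegree ≤ n → 0 < |aeval ζ P| →
      c * height P ^ (-(d : ℝ)) ≤ |aeval ζ P| := by
  have hint : IsIntegral ℚ ζ := hζ.isIntegral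
  set m := minpoly ℚ ζ with hm
  obtain ⟨b, hb, hF⟩ := IsLocalization.integerNormalization_spec (nonZeroDivisors ℤ) m
  set F := IsLocalization.integerNormalization (nonZeroDivisors ℤ) m
  have hb0 : b ≠ 0 := nonZeroDivisors.ne_zero hb
  have hm0 : m ≠ 0 := minpoly.ne_zero hint
  have hFm (A : Type) [CommRing A] [Algebra ℚ A] (z : A) : aeval z F = b • aeval z m := by
    rw [← map_zsmul, ← hF, aeval_map_algebraMap]
  have hF0 : F ≠ 0 := by
    intro h0
    rw [h0, Polynomial.map_zero] at hF
    exact smul_ne_zero hb0 hm0 hF.symm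
  set G := F.map (algebraMap ℤ ℂ) with hG
  have hinj : Function.Injective (algebraMap ℤ ℂ) := (algebraMap ℤ ℂ).injective_int
  have hG0 : G ≠ 0 := (Polynomial.map_ne_zero_iff hinj).2 hF0
  -- a common root with the minimal polynomial forces `P` to vanish at `ζ`
  have hcommon : ∀ P : ℤ[X], ∀ z ∈ G.roots, aeval z P = 0 → aeval ζ P = 0 := by
    intro P z hz hPz
    have hz0 : aeval z F = 0 := by
      have := (mem_roots hG0).1 hz
      rwa [IsRoot.def, hG, eval_map_algebraMap] at this
    rw [hFm, smul_eq_zero_iff_right hb0] at hz0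
    have hmz : m = minpoly ℚ z :=
      minpoly.eq_of_irreducible_of_monic (minpoly.irreducible hint) hz0 (minpoly.monic hint)
    have hdvd : m ∣ P.map (algebraMap ℤ ℚ) := by
      rw [hmz]
      exact minpoly.dvd _ _ (by rw [aeval_map_algebraMap, hPz])
    rw [← aeval_map_algebraMap (A := ℚ)]
    exact (minpoly.dvd_iff).1 hdvd
  have hζG : (ζ : ℂ) ∈ G.roots := by
    rw [mem_roots hG0, IsRoot.def, hG, eval_map_algebraMap]
    have h1 : aeval ζ F = 0 := by rw [hFm, hm, minpoly.aeval, smul_zero]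
    have h2 := aeval_algebraMap_apply ℂ ζ F
    rw [h1, map_zero] at h2
    exact h2
  obtain ⟨A, hA1, hA⟩ : ∃ A : ℝ, 1 ≤ A ∧ ∀ z ∈ G.roots, ‖z‖ ≤ A := by
    obtain ⟨A, hA⟩ := (G.roots.toFinset.finite_toSet.image fun z : ℂ => ‖z‖).bddAbove
    exact ⟨max A 1, le_max_right _ _, fun z hz =>
      (hA ⟨z, by simpa using hz, rfl⟩).trans (le_max_left _ _)⟩
  obtain ⟨t, ht⟩ := Multiset.exists_cons_of_mem hζG
  have hlc : 0 < ‖G.leadingCoeff‖ := norm_pos_iff.2 (leadingCoeff_ne_zero.2 hG0)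
  refine ⟨(‖G.leadingCoeff‖ ^ n * ((n + 1) * A ^ n) ^ t.card)⁻¹, by positivity, t.card,
    fun P hP h0 => ?_⟩
  have hH : 0 < height P := one_pos.trans_le (one_le_height (ne_zero_of_abs_aeval_pos h0))
  have hres := resultant_eq_prod_eval G (P.map (algebraMap ℤ ℂ)) n (natDegree_map_le.trans hP)
    (IsAlgClosed.splits G)
  rw [hG, resultant_map_map, ← hG] at hres
  set r := resultant F P G.natDegree n
  simp only [eval_map_algebraMap] at hres
  have hr0 : r ≠ 0 := by
    intro hr
    rw [hr, map_zero, eq_comm, mul_eq_zero] at hres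
    rcases hres with h | h
    · exact pow_ne_zero n (leadingCoeff_ne_zero.2 hG0) h
    · obtain ⟨z, hz, hz0⟩ := Multiset.mem_map.1 (Multiset.prod_eq_zero_iff.1 h)
      rw [hcommon P z hz hz0] at h0
      simp at h0
  have hr1 : 1 ≤ ‖(algebraMap ℤ ℂ) r‖ := by
    rw [eq_intCast, Complex.norm_intCast]
    exact_mod_cast Int.one_le_abs hr0
  have hζP : ‖aeval (ζ : ℂ) P‖ = |aeval ζ P| := by
    have h2 := aeval_algebraMap_apply ℂ ζ P
    rw [Complex.coe_algebraMap] at h2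
    rw [h2, Complex.norm_real, Real.norm_eq_abs]
  rw [hres, ht, Multiset.map_cons, Multiset.prod_cons, norm_mul, norm_mul, norm_pow, hζP] at hr1
  have htb : ‖(t.map fun z => aeval z P).prod‖ ≤ ((n + 1) * A ^ n * height P) ^ t.card :=
    norm_multiset_prod_map_le (by positivity) fun z hz =>
      norm_aeval_le hP hA1 (hA z (ht ▸ Multiset.mem_cons_of_mem hz))
  rw [Real.rpow_neg hH.le, Real.rpow_natCast, ← mul_inv, inv_le_iff_one_le_mul₀ (by positivity)]
  calc 1 ≤ ‖G.leadingCoeff‖ ^ n * (|aeval ζ P| * ‖(t.map fun z => aeval z P).prod‖) := hr1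
    _ ≤ ‖G.leadingCoeff‖ ^ n * (|aeval ζ P| * ((n + 1) * A ^ n * height P) ^ t.card) := by gcongr
    _ = _ := by rw [mul_pow _ (height P)]; ring

lemma transcendental_of_wExp_eq_top {ζ : ℝ} {n : ℕ} (h : wExp n ζ = ⊤) : Transcendental ℚ ζ := by
  intro halg
  obtain ⟨c, hc, d, hcd⟩ := exists_lower_bound_of_isAlgebraic halg n
  have := wExp_le_of_lower_bound hc hcd
  rw [h, top_le_iff] at this
  exact EReal.coe_ne_top _ this

/-- Irrational numbers of degree two are badly approximable. -/
lemma exists_pos_le_mul_abs_of_quadratic {ζ : ℝ} (hζ : Irrational ζ) {f : ℤ[X]} (hf : f ≠ 0)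
    (hdeg : f.natDegree ≤ 2) (h0 : aeval ζ f = 0) :
    ∃ c > 0, ∀ q p : ℤ, 0 < q → c ≤ q * |q * ζ - p| := by
  obtain ⟨A, hA, h⟩ := Liouville.exists_pos_real_of_irrational_root hζ hf
    (by rwa [eval_map_algebraMap])
  refine ⟨A⁻¹, inv_pos.2 hA, fun q p hq => ?_⟩
  obtain ⟨k, rfl⟩ : ∃ k : ℕ, q = k + 1 := ⟨(q - 1).toNat, by omega⟩
  have h1 := h p k
  have hk : (0 : ℝ) < k + 1 := by positivity
  have h2 : ((k : ℝ) + 1) ^ f.natDegree ≤ (k + 1) ^ 2 := pow_le_pow_right₀ (by linarith) hdeg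
  rw [inv_le_iff_one_le_mul₀ hA]
  push_cast
  have h3 : ((k : ℝ) + 1) * ζ - p = (k + 1) * (ζ - p / (k + 1)) := by field_simp
  rw [h3, abs_mul, abs_of_pos hk]
  calc (1 : ℝ) ≤ (k + 1) ^ f.natDegree * (|ζ - p / (k + 1)| * A) := h1
    _ ≤ (k + 1) ^ 2 * (|ζ - p / (k + 1)| * A) := by gcongr
    _ = _ := by ring

lemma wExp_one_le_of_lower_bound {ζ s c : ℝ} (hs : 0 ≤ s) (hc : 0 < c)
    (h : ∀ q p : ℤ, 0 < q → c * (q : ℝ) ^ (-s) ≤ |q * ζ - p|) :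
    wExp 1 ζ ≤ ((s : ℝ) : EReal) := by
  refine wExp_le_of_lower_bound (lt_min hc one_pos) fun P hP hP0 => ?_
  have hH1 : 1 ≤ height P := one_le_height (ne_zero_of_abs_aeval_pos hP0)
  have hH : 0 < height P := one_pos.trans_le hH1
  have hP' := eq_linPoly_of_natDegree_le_one hP
  set q := P.coeff 1 with hq
  set p := -P.coeff 0 with hp
  have hqH : |(q : ℝ)| ≤ height P := abs_coeff_le_height P 1
  have hval : aeval ζ P = q * ζ - p := by conv_lhs => rw [hP', aeval_linPoly]
  rw [hval] at hP0 ⊢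
  have hmain : ∀ q p : ℤ, 0 < q → |(q : ℝ)| ≤ height P →
      min c 1 * height P ^ (-s) ≤ |q * ζ - p| := by
    intro q p hq hqH
    have hq0 : (0 : ℝ) < q := by exact_mod_cast hq
    rw [abs_of_pos hq0] at hqH
    calc min c 1 * height P ^ (-s) ≤ c * (q : ℝ) ^ (-s) :=
          mul_le_mul (min_le_left _ _)
            (Real.rpow_le_rpow_of_nonpos hq0 hqH (by linarith)) (by positivity) hc.le
      _ ≤ _ := h q p hq
  rcases lt_trichotomy q 0 with hneg | h0 | hpos
  · have h1 := hmain (-q) (-p) (by omega) (by simpa using hqH)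
    have h2 : |((-q : ℤ) : ℝ) * ζ - ((-p : ℤ) : ℝ)| = |q * ζ - p| := by
      rw [← abs_neg]; push_cast; ring_nf
    rwa [h2] at h1
  · have h1 : (1 : ℝ) ≤ |q * ζ - p| := by
      rw [h0] at hP0 ⊢
      simp only [Int.cast_zero, zero_mul, zero_sub, abs_neg, abs_pos] at hP0 ⊢
      exact_mod_cast Int.one_le_abs (by exact_mod_cast hP0)
    calc min c 1 * height P ^ (-s) ≤ 1 * 1 :=
          mul_le_mul (min_le_right _ _)
            (Real.rpow_le_one_of_one_le_of_nonpos hH1 (by linarith)) (by positivity) zero_le_one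
      _ ≤ _ := by linarith
  · exact hmain q p hpos hqH

lemma wExp_one_eq_one_of_quadratic {ζ : ℝ} (hζ : Irrational ζ) {f : ℤ[X]} (hf : f ≠ 0)
    (hdeg : f.natDegree ≤ 2) (h0 : aeval ζ f = 0) : wExp 1 ζ = ((1 : ℝ) : EReal) := by
  refine le_antisymm ?_ (one_le_wExp_one hζ)
  obtain ⟨c, hc, h⟩ := exists_pos_le_mul_abs_of_quadratic hζ hf hdeg h0
  refine wExp_one_le_of_lower_bound zero_le_one hc fun q p hq => ?_
  rw [Real.rpow_neg_one, ← div_eq_mul_inv, div_le_iff₀ (by exact_mod_cast hq), mul_comm]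
  exact h q p hq

/-! ### Simultaneous approximation near quadratic numbers -/

/-- The sequence `a^i y_i`, where `y` satisfies `a y_{i+2} + b y_{i+1} + c y_i = 0` and starts with
`y_0 = q`, `y_1 = p`; the factors `a^i` make it integral. -/
def quadSeq (a b c q p : ℤ) : ℕ → ℤ
  | 0 => q
  | 1 => a * p
  | i + 2 => -b * quadSeq a b c q p (i + 1) - a * c * quadSeq a b c q p i

lemma abs_pow_mul_sub_quadSeq_le {ζ Z H : ℝ} {a b c q p : ℤ} (hZ : 1 ≤ Z) (hζ : |ζ| ≤ Z)
    (hH : 1 ≤ H) (ha : |(a : ℝ)| ≤ H) (hb : |(b : ℝ)| ≤ H) (hc : |(c : ℝ)| ≤ H) (i : ℕ) :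
    |ζ ^ i * (a ^ i * q) - quadSeq a b c q p i| ≤
      (3 * H ^ 2 * Z) ^ i * (|q * ζ - p| + |(q : ℝ)| * |a * ζ ^ 2 + b * ζ + c|) := by
  set ε := a * ζ ^ 2 + b * ζ + c with hε
  set t := |q * ζ - p| + |(q : ℝ)| * |ε| with ht
  have ht0 : 0 ≤ t := by positivity
  set G := 3 * H ^ 2 * Z with hG
  have hH2 : H ≤ H ^ 2 := by nlinarith
  have hGH : H * 3 ≤ G := by nlinarith
  have hG0 : 0 < G := by positivity
  induction i using Nat.strong_induction_on with
  | _ i ih =>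
  rcases i with _ | _ | i
  · simpa [quadSeq] using ht0
  · have h1 : ζ ^ (0 + 1) * ((a : ℝ) ^ (0 + 1) * q) - quadSeq a b c q p (0 + 1)
        = a * (q * ζ - p) := by simp [quadSeq]; ring
    rw [h1, abs_mul, zero_add, pow_one]
    have h2 : |q * ζ - p| ≤ t := by rw [ht]; linarith [mul_nonneg (abs_nonneg (q : ℝ)) (abs_nonneg ε)]
    gcongr
    linarith
  · have h0 := ih i (by omega)
    have h1 := ih (i + 1) (by omega)
    have hqε : |(q : ℝ)| * |ε| ≤ t := by rw [ht]; linarith [abs_nonneg (q * ζ - p)]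
    have hrec : ζ ^ (i + 2) * ((a : ℝ) ^ (i + 2) * q) - quadSeq a b c q p (i + 2)
        = -b * (ζ ^ (i + 1) * ((a : ℝ) ^ (i + 1) * q) - quadSeq a b c q p (i + 1))
          - a * c * (ζ ^ i * ((a : ℝ) ^ i * q) - quadSeq a b c q p i)
          + a ^ (i + 1) * ζ ^ i * (q * ε) := by
      simp only [quadSeq]
      push_cast
      rw [hε]
      ring
    rw [hrec]
    have e1 : |-(b : ℝ) * (ζ ^ (i + 1) * ((a : ℝ) ^ (i + 1) * q) - quadSeq a b c q p (i + 1))|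
        ≤ H * (G ^ (i + 1) * t) := by
      rw [abs_mul, abs_neg]; gcongr
    have e2 : |a * c * (ζ ^ i * ((a : ℝ) ^ i * q) - quadSeq a b c q p i)|
        ≤ H * H * (G ^ i * t) := by
      rw [abs_mul, abs_mul]; gcongr
    have e3 : |a ^ (i + 1) * ζ ^ i * (q * ε)| ≤ H ^ (i + 1) * Z ^ i * t := by
      rw [abs_mul, abs_mul, abs_mul, abs_pow, abs_pow]; gcongr
    have f1 : H * (G ^ (i + 1) * t) * 3 ≤ G ^ (i + 2) * t := by
      calc H * (G ^ (i + 1) * t) * 3 = (H * 3) * (G ^ (i + 1) * t) := by ring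
        _ ≤ G * (G ^ (i + 1) * t) := by gcongr
        _ = _ := by ring
    have f2 : H * H * (G ^ i * t) * 3 ≤ G ^ (i + 2) * t := by
      calc H * H * (G ^ i * t) * 3 ≤ (H * 3) * (H * 3) * (G ^ i * t) := by
            nlinarith [mul_nonneg (mul_nonneg (zero_le_one.trans hH) (zero_le_one.trans hH))
              (mul_nonneg (pow_nonneg hG0.le i) ht0)]
        _ ≤ G * G * (G ^ i * t) := by gcongr
        _ = _ := by ring
    have f3 : H ^ (i + 1) * Z ^ i * t * 3 ≤ G ^ (i + 2) * t := by
      have hHZ : H * Z ≤ G := by rw [hG]; nlinarith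
      calc H ^ (i + 1) * Z ^ i * t * 3 = (H * Z) ^ i * (H * 3) * t := by rw [mul_pow]; ring
        _ ≤ G ^ i * (G * G) * t := by
            have hG1 : 1 ≤ G := by linarith
            exact mul_le_mul_of_nonneg_right (mul_le_mul (pow_le_pow_left₀ (by positivity) hHZ i)
              (hGH.trans (le_mul_of_one_le_left hG0.le hG1)) (by positivity) (by positivity)) ht0
        _ = _ := by ring
    calc _ ≤ |-(b : ℝ) * (ζ ^ (i + 1) * ((a : ℝ) ^ (i + 1) * q) - quadSeq a b c q p (i + 1))|
          + |a * c * (ζ ^ i * ((a : ℝ) ^ i * q) - quadSeq a b c q p i)|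
          + |a ^ (i + 1) * ζ ^ i * (q * ε)| :=
          (abs_add_le _ _).trans (by gcongr; exact abs_sub _ _)
      _ ≤ _ := by linarith

/-- If `P = a T² + b T + c` is small at `ζ`, then a rational approximation `p / q` to `ζ` extends
to an approximation of `ζ, …, ζ^n` along the recurrence attached to `P`. -/
lemma exists_isApprox_of_quadratic {ζ Z H : ℝ} {a b c q p : ℤ} (hZ : 1 ≤ Z) (hζ : |ζ| ≤ Z)
    (hH : 1 ≤ H) (ha : |(a : ℝ)| ≤ H) (hb : |(b : ℝ)| ≤ H) (hc : |(c : ℝ)| ≤ H) (ha0 : a ≠ 0)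
    (hq0 : q ≠ 0) {n : ℕ} (hn : 1 ≤ n) :
    ∃ y : ℕ → ℤ, y 0 = a ^ n * q ∧ y 1 = a ^ n * p ∧ IsApprox n ζ
      ((3 * H ^ 2 * Z) ^ n * (|q * ζ - p| + |(q : ℝ)| * |a * ζ ^ 2 + b * ζ + c|))
      (H ^ n * |(q : ℝ)|) y := by
  refine ⟨fun i => a ^ (n - i) * quadSeq a b c q p i, by simp [quadSeq], ?_, ?_, ?_, ?_⟩
  · obtain ⟨m, rfl⟩ : ∃ m, n = m + 1 := ⟨n - 1, by omega⟩
    simp only [quadSeq, Nat.add_sub_cancel]; ring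
  · simpa [quadSeq] using ⟨fun h => absurd h ha0, hq0⟩
  · simp only [quadSeq, Nat.sub_zero]
    push_cast
    rw [abs_mul, abs_pow]
    gcongr
  · intro i hi
    have h := abs_pow_mul_sub_quadSeq_le (q := q) (p := p) hZ hζ hH ha hb hc i
    set t := |q * ζ - p| + |(q : ℝ)| * |a * ζ ^ 2 + b * ζ + c|
    have ht0 : 0 ≤ t := by positivity
    have hfac : ζ ^ i * ((a ^ (n - 0) * quadSeq a b c q p 0 : ℤ) : ℝ)
        - ((a ^ (n - i) * quadSeq a b c q p i : ℤ) : ℝ)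
        = a ^ (n - i) * (ζ ^ i * (a ^ i * q) - quadSeq a b c q p i) := by
      simp only [quadSeq, Nat.sub_zero]
      push_cast
      rw [show (a : ℝ) ^ n = a ^ (n - i) * a ^ i by rw [← pow_add, Nat.sub_add_cancel hi]]
      ring
    rw [hfac, abs_mul, abs_pow]
    have hHG : H ≤ 3 * H ^ 2 * Z := by nlinarith
    calc |(a : ℝ)| ^ (n - i) * |ζ ^ i * (a ^ i * q) - quadSeq a b c q p i|
        ≤ (3 * H ^ 2 * Z) ^ (n - i) * ((3 * H ^ 2 * Z) ^ i * t) := by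
          gcongr
          linarith
      _ = _ := by rw [← mul_assoc, ← pow_add, Nat.sub_add_cancel hi]

lemma lambdaExp_eq_one_of_quadratic {ζ : ℝ} (hζ : Irrational ζ) {f : ℤ[X]} (hf : f ≠ 0)
    (hdeg : f.natDegree ≤ 2) (h0 : aeval ζ f = 0) {n : ℕ} (hn : 1 ≤ n) : lambdaExp n ζ = 1 := by
  have hn1 : (1 : ℝ) ≤ n := by exact_mod_cast hn
  refine le_antisymm ?_ ?_
  · have h := lambdaExp_le_of_wExp_one_eq hζ (wExp_one_eq_one_of_quadratic hζ hf hdeg h0) hn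
    rwa [max_eq_left (by rw [div_le_one (by linarith)]; linarith)] at h
  set Z := max 1 |ζ|
  have hZ1 : 1 ≤ Z := le_max_left _ _
  have hH := one_le_height hf
  have hfq := eq_quadPoly_of_natDegree_le_two hdeg
  have hval : (f.coeff 2 : ℝ) * ζ ^ 2 + f.coeff 1 * ζ + f.coeff 0 = 0 := by
    rw [← aeval_quadPoly, ← hfq, h0]
  have ha0 : f.coeff 2 ≠ 0 := by
    intro h2
    have h1 : f.coeff 1 ≠ 0 := by
      intro h1
      rw [h1, h2] at hval
      have h3 : f.coeff 0 = 0 := by simpa using hval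
      exact hf (by rw [hfq, h1, h2, h3]; simp [quadPoly])
    have h4 := abs_mul_sub_pos hζ h1 (-f.coeff 0)
    rw [h2] at hval
    push_cast at h4 hval
    rw [show (f.coeff 1 : ℝ) * ζ - -(f.coeff 0 : ℝ) = 0 by linarith] at h4
    simp at h4
  rw [← EReal.coe_one]
  set B := height f ^ n with hB
  have hB1 : 1 ≤ B := one_le_pow₀ hH
  refine le_lambdaExp_of_isApprox (C := (3 * height f ^ 2 * Z) ^ n * B) fun X₀ => ?_
  obtain ⟨N, hN⟩ := exists_nat_gt (max 1 X₀)
  have hN1 : (1 : ℝ) < N := (le_max_left _ _).trans_lt hN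
  obtain ⟨q, p, hq, hqN, -, hle⟩ := exists_coprime_abs_mul_sub_le ζ
    (show 0 < N by exact_mod_cast one_pos.trans hN1)
  obtain ⟨y, -, -, hy⟩ := exists_isApprox_of_quadratic (p := p) hZ1 (le_max_right 1 |ζ|) hH
    (abs_coeff_le_height f 2) (abs_coeff_le_height f 1) (abs_coeff_le_height f 0) ha0 hq.ne' hn
  have hqN' : |(q : ℝ)| ≤ N := by
    rw [abs_of_pos (by exact_mod_cast hq)]; exact_mod_cast hqN
  refine ⟨B * N, ?_, y, hy.1, hy.2.1.trans (by gcongr), fun i hi => (hy.2.2 i hi).trans ?_⟩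
  · nlinarith [(le_max_right 1 X₀).trans_lt hN]
  · rw [hval, abs_zero, mul_zero, add_zero, mul_assoc ((3 * height f ^ 2 * Z) ^ n)]
    gcongr
    refine hle.trans ?_
    rw [Real.rpow_neg_one, mul_inv, ← mul_assoc, mul_inv_cancel₀ (by positivity), one_mul, one_div]
    gcongr
    linarith

/-- If `P = a T² + b T + c` is small at `ζ` and has no rational root close to `ζ`, then `ζ` is
badly approximable up to the factor `h` in the range up to `Q`, which yields two independent
rational approximations of comparable quality. -/
lemma exists_two_rational_approx {ζ : ℝ} {a b c : ℤ} {h Z Q : ℕ} (hh : 1 ≤ h) (hZ : 1 ≤ Z)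
    (hζ : |ζ| ≤ Z) (hQ : 1 ≤ Q) (ha : |(a : ℝ)| ≤ h) (hb : |(b : ℝ)| ≤ h) (ha0 : a ≠ 0)
    (hε : (Q : ℝ) ^ 2 * |a * ζ ^ 2 + b * ζ + c| ≤ 1 / 2)
    (hlin : ∀ q p : ℤ, 0 < q → q ≤ h → 1 / ((Q : ℝ) + 1) < |q * ζ - p|) :
    ∃ q p q' p' : ℤ, 0 < q ∧ (q : ℝ) ≤ 8 * h * Z * Q ∧ 0 < q' ∧ (q' : ℝ) ≤ 8 * h * Z * Q ∧
      |q * ζ - p| ≤ 1 / Q ∧ |q' * ζ - p'| ≤ 1 / Q ∧ q * p' ≠ q' * p := by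
  have hh1 : (1 : ℝ) ≤ h := by exact_mod_cast hh
  have hZ1 : (1 : ℝ) ≤ Z := by exact_mod_cast hZ
  have hQ1 : (1 : ℝ) ≤ Q := by exact_mod_cast hQ
  obtain ⟨q, p, hq, hqQ, hco, hle⟩ := exists_coprime_abs_mul_sub_le ζ hQ
  have hq1 : (1 : ℝ) ≤ q := by exact_mod_cast hq
  have hqQ' : (q : ℝ) ≤ Q := by exact_mod_cast hqQ
  have hle1 : |q * ζ - p| ≤ 1 / Q := hle.trans (by gcongr; linarith)
  have hle2 : |q * ζ - p| ≤ 1 := hle1.trans (by rw [div_le_one (by linarith)]; exact hQ1)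
  -- `q² P(p/q)` is a nonzero integer
  have hN : a * p ^ 2 + b * p * q + c * q ^ 2 ≠ 0 := by
    intro h0
    have hdvd : q ∣ a := by
      refine (hco.pow_right (n := 2)).dvd_of_dvd_mul_right ⟨-(b * p + c * q), ?_⟩
      linear_combination h0
    have hqa : q ≤ |a| := Int.le_of_dvd (abs_pos.2 ha0) ((dvd_abs _ _).2 hdvd)
    have hah : |a| ≤ h := by exact_mod_cast ha
    exact absurd hle (not_le.2 (hlin q p hq (hqa.trans hah)))
  have hN1 : (1 : ℝ) ≤ |a * (p : ℝ) ^ 2 + b * p * q + c * q ^ 2| := by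
    exact_mod_cast Int.one_le_abs hN
  have hqζ : |q * ζ| ≤ q * Z := by rw [abs_mul, abs_of_pos (by linarith)]; gcongr
  have hp : |(p : ℝ)| ≤ 2 * (q * Z) := by
    calc |(p : ℝ)| = |q * ζ - (q * ζ - p)| := by ring_nf
      _ ≤ |q * ζ| + |q * ζ - p| := abs_sub _ _
      _ ≤ q * Z + 1 := by gcongr
      _ ≤ _ := by nlinarith
  have hfac : |a * (p + q * ζ) + b * q| ≤ 4 * h * Z * q := by
    calc |a * (p + q * ζ) + b * q| ≤ |(a : ℝ)| * (|(p : ℝ)| + |q * ζ|) + |(b : ℝ)| * |(q : ℝ)| := by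
          refine (abs_add_le _ _).trans ?_
          rw [abs_mul, abs_mul]
          gcongr
          exact abs_add_le _ _
      _ ≤ h * (2 * (q * Z) + q * Z) + h * q := by
          rw [abs_of_pos (show (0 : ℝ) < q by linarith)]
          gcongr
      _ ≤ _ := by nlinarith [mul_nonneg (show (0 : ℝ) ≤ h by linarith) (show (0 : ℝ) ≤ q by linarith)]
  have hlow : 1 / (8 * h * Z * Q : ℝ) ≤ |q * ζ - p| := by
    have h1 : |a * (p : ℝ) ^ 2 + b * p * q + c * q ^ 2| ≤
        q ^ 2 * |a * ζ ^ 2 + b * ζ + c| + |q * ζ - p| * (4 * h * Z * q) := by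
      calc _ = |q ^ 2 * (a * ζ ^ 2 + b * ζ + c) - (q * ζ - p) * (a * (p + q * ζ) + b * q)| := by
            ring_nf
        _ ≤ |q ^ 2 * (a * ζ ^ 2 + b * ζ + c)| + |(q * ζ - p) * (a * (p + q * ζ) + b * q)| :=
            abs_sub _ _
        _ ≤ _ := by
            rw [abs_mul, abs_mul, abs_of_pos (by positivity : (0 : ℝ) < (q : ℝ) ^ 2)]
            gcongr
    have h2 : (q : ℝ) ^ 2 * |a * ζ ^ 2 + b * ζ + c| ≤ 1 / 2 := le_trans (by gcongr) hε
    have h3 : |q * ζ - p| * (4 * h * Z * q) ≤ |q * ζ - p| * (4 * h * Z * Q) := by gcongr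
    rw [div_le_iff₀ (by positivity)]
    linarith
  obtain ⟨q', p', hq', hqQ'', -, hle'⟩ := exists_coprime_abs_mul_sub_le ζ
    (show 0 < 8 * h * Z * Q by positivity)
  have hlt : |q' * ζ - p'| < 1 / (8 * h * Z * Q : ℝ) := by
    refine hle'.trans_lt ?_
    push_cast
    gcongr
    linarith
  have h8 : (1 : ℝ) ≤ 8 * h * Z := by nlinarith
  refine ⟨q, p, q', p', hq, by nlinarith, hq', by exact_mod_cast hqQ'', hle1,
    hlt.le.trans (by gcongr; nlinarith), ?_⟩
  intro heq
  obtain ⟨t, ht⟩ : q ∣ q' := hco.dvd_of_dvd_mul_right ⟨p', by linarith⟩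
  have hpt : p' = t * p := by
    apply mul_left_cancel₀ hq.ne'
    rw [heq, ht]; ring
  have ht0 : t ≠ 0 := by rintro rfl; simp at ht; omega
  have ht1 : (1 : ℝ) ≤ |(t : ℝ)| := by exact_mod_cast Int.one_le_abs ht0
  have h4 : |(q' : ℝ) * ζ - p'| = |(t : ℝ)| * |q * ζ - p| := by
    rw [← abs_mul, ht, hpt]; push_cast; ring_nf
  rw [h4] at hlt
  nlinarith [abs_nonneg (q * ζ - p)]

/-- Fractions with denominator at most `h` cannot approximate `ζ` too well when the linear forms
in `1, ζ` are bounded below by a power of the height. -/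
lemma one_div_lt_abs_of_lower_bound {ζ c₀ : ℝ} {k h K : ℕ} {Z : ℝ} (hirr : Irrational ζ)
    (hlow : ∀ P : ℤ[X], P.natDegree ≤ 1 → 0 < |aeval ζ P| →
      c₀ * height P ^ (-(k : ℝ)) ≤ |aeval ζ P|) (hc₀ : 0 < c₀) (hZ : 1 ≤ Z) (hζZ : |ζ| ≤ Z)
    (hh : (1 : ℝ) ≤ h) (hhk : (2 * Z) ^ k < c₀ * h) (hKk : k + 1 ≤ K) :
    ∀ q p : ℤ, 0 < q → q ≤ h → 1 / (((h ^ K : ℕ) : ℝ) + 1) < |q * ζ - p| := by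
  have hh0 : (0 : ℝ) < h := by linarith
  have hQ : (1 : ℝ) ≤ (h : ℝ) ^ K := one_le_pow₀ hh
  intro q p hq hqh
  by_contra! hcon
  push_cast at hcon
  have hq1 : (1 : ℝ) ≤ q := by exact_mod_cast hq
  have hqh' : (q : ℝ) ≤ h := by exact_mod_cast hqh
  have hcon1 : |q * ζ - p| ≤ 1 := hcon.trans (by rw [div_le_one (by positivity)]; linarith)
  have hp : |(p : ℝ)| ≤ 2 * Z * h := by
    calc |(p : ℝ)| = |q * ζ - (q * ζ - p)| := by ring_nf
      _ ≤ |q * ζ| + |q * ζ - p| := abs_sub _ _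
      _ ≤ h * Z + 1 := by
        rw [abs_mul, abs_of_pos (show (0 : ℝ) < q by linarith)]; gcongr
      _ ≤ _ := by nlinarith
  have hL : height (linPoly q p) ≤ 2 * Z * h := by
    refine height_linPoly_le ?_ hp
    rw [abs_of_pos (show (0 : ℝ) < q by linarith)]; nlinarith
  have hpos : 0 < |aeval ζ (linPoly q p)| := by
    rw [aeval_linPoly]; exact abs_mul_sub_pos hirr hq.ne' p
  have hL0 : 0 < height (linPoly q p) :=
    one_pos.trans_le (one_le_height (ne_zero_of_abs_aeval_pos hpos))
  have h3 := hlow _ (natDegree_linPoly_le q p) hpos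
  rw [aeval_linPoly, Real.rpow_neg hL0.le, Real.rpow_natCast, ← div_eq_mul_inv,
    div_le_iff₀ (by positivity)] at h3
  have h4 : c₀ ≤ 1 / ((h : ℝ) ^ K + 1) * (2 * Z * h) ^ k :=
    h3.trans (mul_le_mul hcon (pow_le_pow_left₀ hL0.le hL k) (by positivity) (by positivity))
  have h5 : (h : ℝ) ^ (k + 1) ≤ (h : ℝ) ^ K + 1 :=
    (pow_le_pow_right₀ hh hKk).trans (by linarith)
  have h6 : c₀ * (h : ℝ) ^ (k + 1) ≤ (2 * Z * h) ^ k := by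
    have h7 : c₀ * ((h : ℝ) ^ K + 1) ≤ (2 * Z * h) ^ k := by
      rw [one_div, ← div_eq_inv_mul, le_div_iff₀ (by positivity)] at h4
      exact h4
    exact (mul_le_mul_of_nonneg_left h5 hc₀.le).trans h7
  rw [mul_pow (2 * (Z : ℝ)), pow_succ, mul_comm ((h : ℝ) ^ k), ← mul_assoc] at h6
  have h8 := le_of_mul_le_mul_right h6 (by positivity)
  linarith

/-- Choice of the parameters in `exists_isApprox_of_quadratic`: when `P` is smaller at `ζ` than a
high power of `1 / h`, a rational approximation of denominator about `h^K` extends to an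
approximation of quality `l < 1`. -/
lemma exists_isApprox_of_small_quadratic {ζ l : ℝ} {a b c q p : ℤ} {h K n : ℕ} {Z : ℝ}
    (hZ : 1 ≤ Z) (hζZ : |ζ| ≤ Z) (hn : 1 ≤ n) (hh : (1 : ℝ) ≤ h) (h8 : 8 * Z ≤ h)
    (h3Z : 2 * (3 * Z) ^ n ≤ h) (ha : |(a : ℝ)| ≤ h) (hb : |(b : ℝ)| ≤ h) (hc : |(c : ℝ)| ≤ h)
    (ha0 : a ≠ 0) (hKl : l * (n + 2) + 2 * n + 1 ≤ K * (1 - l))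
    (hε : |a * ζ ^ 2 + b * ζ + c| * (h : ℝ) ^ (2 * K + 2) ≤ 1)
    (hq : 0 < q) (hqQ : (q : ℝ) ≤ 8 * h * Z * h ^ K) (hqp : |q * ζ - p| ≤ 1 / (h : ℝ) ^ K) :
    ∃ y : ℕ → ℤ, y 0 = a ^ n * q ∧ y 1 = a ^ n * p ∧
      IsApprox n ζ (((h : ℝ) ^ (n + 2 + K)) ^ (-l)) ((h : ℝ) ^ (n + 2 + K)) y := by
  have hh0 : (0 : ℝ) < h := by linarith
  set ε := |a * ζ ^ 2 + b * ζ + c| with hεdef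
  obtain ⟨y, hy0, hy1, hne, hX, herr⟩ := exists_isApprox_of_quadratic (p := p) hZ hζZ hh
    ha hb hc ha0 hq.ne' hn
  rw [abs_of_pos (by exact_mod_cast hq : (0 : ℝ) < q)] at hX herr
  have hqQ2 : (q : ℝ) ≤ (h : ℝ) ^ (K + 2) := by
    calc (q : ℝ) ≤ 8 * h * Z * h ^ K := hqQ
      _ = 8 * Z * h * h ^ K := by ring
      _ ≤ h * h * h ^ K := by gcongr
      _ = _ := by ring
  refine ⟨y, hy0, hy1, hne, hX.trans ?_, fun i hi => (herr i hi).trans ?_⟩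
  · calc (h : ℝ) ^ n * q ≤ (h : ℝ) ^ n * (h : ℝ) ^ (K + 2) := by gcongr
      _ = _ := by ring
  · have h3 : (q : ℝ) * ε ≤ 1 / (h : ℝ) ^ K := by
      rw [le_div_iff₀ (by positivity)]
      calc (q : ℝ) * ε * h ^ K ≤ (h : ℝ) ^ (K + 2) * ε * h ^ K := by gcongr
        _ = ε * h ^ (2 * K + 2) := by ring
        _ ≤ 1 := hε
    calc (3 * (h : ℝ) ^ 2 * Z) ^ n * (|q * ζ - p| + q * ε)
        ≤ (3 * (h : ℝ) ^ 2 * Z) ^ n * (1 / (h : ℝ) ^ K + 1 / (h : ℝ) ^ K) := by gcongr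
      _ = 2 * (3 * Z) ^ n * ((h : ℝ) ^ (2 * n) * ((h : ℝ) ^ K)⁻¹) := by
          rw [show 3 * (h : ℝ) ^ 2 * Z = (3 * Z) * h ^ 2 by ring, mul_pow, ← pow_mul]; ring
      _ ≤ h * ((h : ℝ) ^ (2 * n) * ((h : ℝ) ^ K)⁻¹) := by gcongr
      _ = (h : ℝ) ^ (1 + 2 * n - K : ℝ) := by
          rw [Real.rpow_sub hh0, Real.rpow_add hh0, Real.rpow_one, Real.rpow_natCast,
            show (2 * n : ℝ) = ((2 * n : ℕ) : ℝ) by push_cast; rfl, Real.rpow_natCast]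
          ring
      _ ≤ (h : ℝ) ^ ((n + 2 + K : ℕ) * (-l) : ℝ) := by
          refine Real.rpow_le_rpow_of_exponent_le hh ?_
          push_cast
          linarith
      _ = _ := by rw [Real.rpow_mul hh0.le, Real.rpow_natCast]

/-- If `w_1` is finite and `w_2` is infinite, two independent approximations of quality close to `1`
exist for arbitrarily large `X`. -/
lemma one_le_lambdaExpMin_two {ζ : ℝ} (h1 : wExp 1 ζ ≠ ⊤) (h2 : wExp 2 ζ = ⊤)
    (hirr : Irrational ζ) {n : ℕ} (hn : 1 ≤ n) : 1 ≤ lambdaExpMin n 2 ζ := by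
  suffices hmain : ∀ l : ℝ, 0 ≤ l → l < 1 → (l : EReal) ≤ lambdaExpMin n 2 ζ by
    by_contra! hlt
    rw [← EReal.coe_one] at hlt
    obtain ⟨r, hr1, hr2⟩ := EReal.lt_iff_exists_real_btwn.1 hlt
    have h3 := hmain (max r 0) (le_max_right _ _)
      (max_lt (EReal.coe_lt_coe_iff.1 hr2) one_pos)
    exact absurd hr1 (not_lt.2 (le_trans (EReal.coe_le_coe_iff.2 (le_max_left _ _)) h3))
  intro l hl0 hl1
  refine le_sSup ⟨l, frequently_atTop.2 fun X₀ => ?_, rfl⟩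
  obtain ⟨k, hk⟩ : ∃ k : ℕ, wExp 1 ζ < ((k : ℝ) : EReal) := by
    obtain ⟨r, hr, -⟩ := EReal.lt_iff_exists_real_btwn.1 (lt_top_iff_ne_top.2 h1)
    obtain ⟨k, hk⟩ := exists_nat_gt r
    exact ⟨k, hr.trans (EReal.coe_lt_coe_iff.2 hk)⟩
  obtain ⟨c₀, hc₀, hlow⟩ := exists_lower_bound_of_wExp_lt hk
  obtain ⟨Z, hZ⟩ := exists_nat_ge (max 1 |ζ|)
  have hZ1' : (1 : ℝ) ≤ Z := (le_max_left _ _).trans hZ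
  have hZ1 : 1 ≤ Z := by exact_mod_cast hZ1'
  have hζZ : |ζ| ≤ Z := (le_max_right _ _).trans hZ
  -- `K` is so large that the exponent `K - 2n - 1` of the error beats `l (n + 2 + K)`
  obtain ⟨K, hK⟩ := exists_nat_ge (max (k + 1 : ℝ) ((l * (n + 2) + 2 * n + 1) / (1 - l)))
  have hKk : k + 1 ≤ K := by exact_mod_cast (le_max_left _ _).trans hK
  have hKl : l * (n + 2) + 2 * n + 1 ≤ K * (1 - l) :=
    (div_le_iff₀ (by linarith)).1 ((le_max_right _ _).trans hK)
  obtain ⟨H₀, hH₀⟩ := exists_nat_gt (|X₀| + 8 * Z + 2 * (3 * Z) ^ n + (2 * Z) ^ k / c₀ + 1 / c₀)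
  obtain ⟨P, hP, hPH, hP0, hPle⟩ := exists_height_ge_of_lt_wExp
    (show ((2 * K + k + 3 : ℕ) : ℝ) < wExp 2 ζ by rw [h2]; exact EReal.coe_lt_top _) H₀
  obtain ⟨h, hh⟩ : ∃ h : ℕ, (h : ℝ) = height P := by
    obtain ⟨i, hi⟩ := P.exists_eq_supNorm
    refine ⟨(P.coeff i).natAbs, ?_⟩
    rw [height, hi, Int.norm_eq_abs, Nat.cast_natAbs, Int.cast_abs]
  rw [← hh] at hPH hPle
  have hbig : |X₀| + 8 * Z + 2 * (3 * Z) ^ n + (2 * Z) ^ k / c₀ + 1 / c₀ < (h : ℝ) :=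
    hH₀.trans_le hPH
  have p1 : (0 : ℝ) ≤ 2 * (3 * Z) ^ n := by positivity
  have p2 : (0 : ℝ) ≤ (2 * Z) ^ k / c₀ := by positivity
  have p3 : (0 : ℝ) < 1 / c₀ := by positivity
  have p4 := le_abs_self X₀
  have p5 := abs_nonneg X₀
  have hhX : X₀ ≤ h := by linarith
  have h8 : 8 * (Z : ℝ) ≤ h := by linarith
  have h3Z : 2 * (3 * (Z : ℝ)) ^ n ≤ h := by linarith
  have hhk : (2 * (Z : ℝ)) ^ k < c₀ * h := by
    rw [← div_lt_iff₀' hc₀]; linarith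
  have hhc : 1 < c₀ * (h : ℝ) := by
    rw [← div_lt_iff₀' hc₀]; linarith
  have hh1' : (8 : ℝ) ≤ h := by linarith
  have hh0 : (0 : ℝ) < h := by linarith
  have hh1 : (1 : ℝ) ≤ h := by linarith
  have hhn : 1 ≤ h := by exact_mod_cast hh1
  have hcoef (i : ℕ) : |(P.coeff i : ℝ)| ≤ h := hh ▸ abs_coeff_le_height P i
  rw [Real.rpow_neg hh0.le, Real.rpow_natCast] at hPle
  set ε := |aeval ζ P| with hεdef
  have hε : ε * (h : ℝ) ^ (2 * K + k + 3) ≤ 1 := by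
    rwa [← le_div_iff₀ (by positivity), one_div]
  have hεle : ∀ m ≤ 2 * K + k + 3, ε * (h : ℝ) ^ m ≤ 1 := fun m hm =>
    le_trans (by gcongr) hε
  have hval : (P.coeff 2 : ℝ) * ζ ^ 2 + P.coeff 1 * ζ + P.coeff 0 = aeval ζ P := by
    conv_rhs => rw [eq_quadPoly_of_natDegree_le_two hP, aeval_quadPoly]
  have ha0 : P.coeff 2 ≠ 0 := by
    intro ha0
    have hdeg : P.natDegree ≤ 1 := by
      by_contra! hcon
      have h3 : P.natDegree = 2 := by omega
      have h4 : P.leadingCoeff = 0 := by rw [leadingCoeff, h3, ha0]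
      rw [leadingCoeff_eq_zero] at h4
      rw [h4] at h3; simp at h3
    have h3 := hlow P hdeg hP0
    rw [← hh, Real.rpow_neg hh0.le, Real.rpow_natCast, ← div_eq_mul_inv,
      div_le_iff₀ (by positivity)] at h3
    have h4 := hεle (k + 1) (by omega)
    rw [pow_succ, ← mul_assoc] at h4
    nlinarith
  have hQ : (1 : ℝ) ≤ (h : ℝ) ^ K := one_le_pow₀ hh1
  have hlin := one_div_lt_abs_of_lower_bound hirr hlow hc₀ hZ1' hζZ hh1 hhk hKk
  have hQε : (((h ^ K : ℕ) : ℝ)) ^ 2 * |(P.coeff 2 : ℝ) * ζ ^ 2 + P.coeff 1 * ζ + P.coeff 0|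
      ≤ 1 / 2 := by
    rw [hval, ← hεdef]
    have h3 := hεle (2 * K + 1) (by omega)
    push_cast
    rw [pow_succ, mul_comm 2 K, pow_mul, ← mul_assoc] at h3
    have h4 : 0 ≤ ε * ((h : ℝ) ^ K) ^ 2 := by positivity
    nlinarith
  obtain ⟨q, p, q', p', hq, hqQ, hq', hqQ', hqp, hqp', hind⟩ :=
    exists_two_rational_approx hhn hZ1 hζZ (Nat.one_le_pow _ _ hhn) (hcoef 2) (hcoef 1) ha0
      hQε hlin
  push_cast at hqQ hqQ' hqp hqp'
  have hext := fun (q p : ℤ) => exists_isApprox_of_small_quadratic (q := q) (p := p) hZ1' hζZ hn hh1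
    h8 h3Z (hcoef 2) (hcoef 1) (hcoef 0) ha0 hKl
    (by rw [hval]; exact hεle (2 * K + 2) (by omega))
  obtain ⟨y, hy0, hy1, hy⟩ := hext q p hq hqQ hqp
  obtain ⟨y', hy0', hy1', hy'⟩ := hext q' p' hq' hqQ' hqp'
  refine ⟨(h : ℝ) ^ (n + 2 + K), hhX.trans (le_self_pow₀ hh1 (by omega)),
    ![fun i => y i, fun i => y' i], ?_, ?_⟩
  · rw [LinearIndependent.pair_iff]
    intro s t hst
    have e0 := congrFun hst 0
    have e1 := congrFun hst ⟨1, by omega⟩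
    simp only [Pi.add_apply, Pi.smul_apply, smul_eq_mul, Fin.val_zero, Pi.zero_apply, hy0, hy0',
      hy1, hy1'] at e0 e1
    have han : P.coeff 2 ^ n ≠ 0 := pow_ne_zero n ha0
    have f0 : s * q + t * q' = 0 := mul_left_cancel₀ han (by linear_combination e0)
    have f1 : s * p + t * p' = 0 := mul_left_cancel₀ han (by linear_combination e1)
    have hdet : q * p' - q' * p ≠ 0 := sub_ne_zero.2 hind
    constructor
    · exact mul_right_cancel₀ hdet (by linear_combination p' * f0 - q' * f1)
    · exact mul_right_cancel₀ hdet (by linear_combination q * f1 - p * f0)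
  · intro j
    fin_cases j
    · exact hy.simSol
    · exact hy'.simSol

/-! ### Approximations of quality above `1/2` satisfy a quadratic recurrence -/

/-- The Hankel minor `y_i y_{i+2} - y_{i+1}²`. -/
def hankelTwo (y : ℕ → ℤ) (i : ℕ) : ℤ := y i * y (i + 2) - y (i + 1) * y (i + 1)

/-- The minor formed by the rows `i, j, k` of the Hankel matrix with rows
`(y_m, y_{m+1}, y_{m+2})`. -/
def hankelThree (y : ℕ → ℤ) (i j k : ℕ) : ℤ :=
  y i * (y (j + 1) * y (k + 2) - y (j + 2) * y (k + 1))
    - y (i + 1) * (y j * y (k + 2) - y (j + 2) * y k)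
    + y (i + 2) * (y j * y (k + 1) - y (j + 1) * y k)

lemma IsApprox.abs_hankelThree_le {n : ℕ} {ζ δ X Z : ℝ} {y : ℕ → ℤ} (h : IsApprox n ζ δ X y)
    (hZ : 1 ≤ Z) (hζ : |ζ| ≤ Z) (hδ : δ ≤ 1) (hX : 1 ≤ X) {i j k : ℕ} (hi : i + 2 ≤ n)
    (hj : j + 2 ≤ n) (hk : k + 2 ≤ n) :
    |(hankelThree y i j k : ℝ)| ≤ 48 * Z ^ (n + 2) * (X * δ ^ 2) := by
  have hδ0 : 0 ≤ δ := (abs_nonneg _).trans (h.2.2 0 (Nat.zero_le _))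
  have hs (m : ℕ) (hm : m + 1 ≤ n) := h.abs_shift_le hZ hζ hm
  have hy (m : ℕ) (hm : m ≤ n) := h.abs_le hZ hζ hδ hX hm
  set S := 2 * Z * δ with hS
  set Y := 2 * Z ^ n * X with hY
  have hterm : ∀ a b c : ℝ, |a| ≤ Y → |b| ≤ S → |c| ≤ S → |a * (b * c)| ≤ Y * (S * S) := by
    intro a b c ha hb hc
    rw [abs_mul, abs_mul]
    gcongr
  -- subtracting `ζ` times the preceding column makes two of the three columns small
  set s : ℕ → ℝ := fun m => y (m + 1) - ζ * y m with hsdef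
  have hexp : (hankelThree y i j k : ℝ) =
      y i * (s j * s (k + 1)) - y i * (s (j + 1) * s k) - y j * (s i * s (k + 1))
        + y k * (s i * s (j + 1)) + y j * (s (i + 1) * s k) - y k * (s (i + 1) * s j) := by
    simp only [hankelThree, hsdef]
    push_cast
    ring
  rw [hexp]
  have t1 := hterm _ _ _ (hy i (by omega)) (hs j (by omega)) (hs (k + 1) (by omega))
  have t2 := hterm _ _ _ (hy i (by omega)) (hs (j + 1) (by omega)) (hs k (by omega))
  have t3 := hterm _ _ _ (hy j (by omega)) (hs i (by omega)) (hs (k + 1) (by omega))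
  have t4 := hterm _ _ _ (hy k (by omega)) (hs i (by omega)) (hs (j + 1) (by omega))
  have t5 := hterm _ _ _ (hy j (by omega)) (hs (i + 1) (by omega)) (hs k (by omega))
  have t6 := hterm _ _ _ (hy k (by omega)) (hs (i + 1) (by omega)) (hs j (by omega))
  have hfin : 6 * (Y * (S * S)) = 48 * Z ^ (n + 2) * (X * δ ^ 2) := by rw [hS, hY]; ring
  rw [← hfin]
  simp only [hsdef] at t1 t2 t3 t4 t5 t6 ⊢
  rw [_root_.abs_le] at t1 t2 t3 t4 t5 t6 ⊢
  constructor <;> linarith [t1.1, t1.2, t2.1, t2.2, t3.1, t3.2, t4.1, t4.2, t5.1, t5.2, t6.1, t6.2]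

/-- If the first two Hankel rows are dependent and all `3 × 3` minors vanish, the sequence is in
geometric progression, except possibly for its last term. -/
lemma geometric_of_hankelTwo_eq_zero {N : ℕ} {y : ℕ → ℤ}
    (h3 : ∀ j k, j ≤ N → k ≤ N → hankelThree y 0 j k = 0) (h2 : hankelTwo y 0 = 0) :
    ∀ j < N + 1, y 0 * y (j + 1) = y 1 * y j := by
  intro j
  induction j with
  | zero => intro _; rw [zero_add]; ring
  | succ j ih =>
    intro hj
    have e0 := ih (by omega)
    have e1 := h3 j (j + 1) (by omega) (by omega)
    simp only [hankelThree, hankelTwo, zero_add] at e1 h2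
    rw [← sub_eq_zero]
    refine pow_eq_zero_iff (two_ne_zero) |>.1 ?_
    have h2' : y 0 * y 2 - y 1 * y 1 = 0 := h2
    linear_combination (y 0 * y (j + 3) - y 1 * y (j + 2)) * e0 - y 0 * e1 +
      (y j * y (j + 2) - y (j + 1) ^ 2) * h2'

/-- If the first two Hankel rows are independent and all `3 × 3` minors vanish, the sequence
satisfies the recurrence of a primitive quadratic polynomial. -/
lemma exists_primitive_recurrence {N : ℕ} {y : ℕ → ℤ} (hN : 1 ≤ N)
    (h3 : ∀ j k, j ≤ N → k ≤ N → hankelThree y 0 j k = 0) (h2 : hankelTwo y 0 ≠ 0) :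
    ∃ P : ℤ[X], P.IsPrimitive ∧ P.natDegree ≤ 2 ∧ P.coeff 2 ≠ 0 ∧
      ∀ k ≤ N, P.coeff 0 * y k + P.coeff 1 * y (k + 1) + P.coeff 2 * y (k + 2) = 0 := by
  -- the cross product of the first two rows
  set F := quadPoly (y 0 * y 2 - y 1 * y 1) (-(y 0 * y 3 - y 1 * y 2))
    (y 1 * y 3 - y 2 * y 2) 
  have hc2 : F.coeff 2 = y 0 * y 2 - y 1 * y 1 := coeff_two_quadPoly _ _ _
  have hc1 : F.coeff 1 = -(y 0 * y 3 - y 1 * y 2) := coeff_one_quadPoly _ _ _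
  have hc0 : F.coeff 0 = y 1 * y 3 - y 2 * y 2 := coeff_zero_quadPoly _ _ _
  have hFd : F.natDegree ≤ 2 := natDegree_quadPoly_le _ _ _
  have hF2 : F.coeff 2 ≠ 0 := by rw [hc2]; exact h2
  have hmul (i : ℕ) : F.coeff i = F.content * F.primPart.coeff i := by
    conv_lhs => rw [F.eq_C_content_mul_primPart, coeff_C_mul]
  have hcont : F.content ≠ 0 := by
    intro h
    exact hF2 (by rw [hmul, h, zero_mul])
  refine ⟨F.primPart, F.isPrimitive_primPart, by rwa [natDegree_primPart], ?_, fun k hk => ?_⟩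
  · intro h
    exact hF2 (by rw [hmul, h, mul_zero])
  · apply mul_left_cancel₀ hcont
    have e := h3 1 k hN hk
    simp only [hankelThree, zero_add] at e
    have m0 := hmul 0
    have m1 := hmul 1
    have m2 := hmul 2
    rw [hc0] at m0
    rw [hc1] at m1
    rw [hc2] at m2
    norm_num at e
    linear_combination e - y k * m0 - y (k + 1) * m1 - y (k + 2) * m2

/-- The numerators of the Lucas sequence attached to `a₂ T² + a₁ T + a₀`, scaled to be integral. -/
def lucasNum (a₀ a₁ a₂ : ℤ) : ℕ → ℤ
  | 0 => 1
  | 1 => -a₁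
  | i + 2 => -a₁ * lucasNum a₀ a₁ a₂ (i + 1) - a₀ * a₂ * lucasNum a₀ a₁ a₂ i

lemma dvd_lucasNum_sub (a₀ a₁ a₂ : ℤ) : ∀ i, a₀ ∣ lucasNum a₀ a₁ a₂ i - (-a₁) ^ i
  | 0 => by simp [lucasNum]
  | 1 => by simp [lucasNum]
  | i + 2 => by
    obtain ⟨r, hr⟩ := dvd_lucasNum_sub a₀ a₁ a₂ (i + 1)
    refine ⟨-a₁ * r - a₂ * lucasNum a₀ a₁ a₂ i, ?_⟩
    rw [lucasNum]
    linear_combination (-a₁) * hr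

/-- For a sequence satisfying a primitive recurrence, the `2 × 2` Hankel minors are divisible by
high powers of the outer coefficients. -/
lemma exists_hankelTwo_eq_pow_mul {N : ℕ} {y : ℕ → ℤ} {P : ℤ[X]} (hP : P.IsPrimitive)
    (hdeg : P.natDegree ≤ 2) (ha2 : P.coeff 2 ≠ 0)
    (hrec : ∀ k ≤ N, P.coeff 0 * y k + P.coeff 1 * y (k + 1) + P.coeff 2 * y (k + 2) = 0) :
    ∃ c, hankelTwo y 0 = P.coeff 2 ^ N * c ∧ hankelTwo y N = P.coeff 0 ^ N * c := by
  set a₀ := P.coeff 0 with ha₀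
  set a₁ := P.coeff 1 with ha₁
  set a₂ := P.coeff 2 with ha₂
  have hstep : ∀ j, j + 1 ≤ N → a₂ * hankelTwo y (j + 1) = a₀ * hankelTwo y j := by
    intro j hj
    have e0 := hrec j (by omega)
    have e1 := hrec (j + 1) hj
    simp only [hankelTwo]
    simp only [add_assoc, Nat.reduceAdd] at e0 e1 ⊢
    linear_combination y (j + 1) * e1 - y (j + 2) * e0
  have hpow : ∀ j ≤ N, a₂ ^ j * hankelTwo y j = a₀ ^ j * hankelTwo y 0 := by
    intro j
    induction j with
    | zero => simp
    | succ j ih =>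
      intro hj
      calc a₂ ^ (j + 1) * hankelTwo y (j + 1) = a₂ ^ j * (a₂ * hankelTwo y (j + 1)) := by ring
        _ = a₀ * (a₂ ^ j * hankelTwo y j) := by rw [hstep j hj]; ring
        _ = _ := by rw [ih (by omega)]; ring
  have hM : ∀ i ≤ N, a₂ ^ i * (y 0 * y (i + 2) - y 1 * y (i + 1))
      = lucasNum a₀ a₁ a₂ i * hankelTwo y 0 := by
    intro i
    induction i using Nat.strong_induction_on with
    | _ i ih =>
    intro hi
    rcases i with _ | _ | i
    · simp [lucasNum, hankelTwo]
    · have e0 := hrec 0 (by omega)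
      have e1 := hrec 1 (by omega)
      simp only [lucasNum, hankelTwo]
      simp only [zero_add, Nat.reduceAdd] at e0 e1 ⊢
      linear_combination y 0 * e1 - y 1 * e0
    · have e0 := hrec (i + 1) (by omega)
      have e1 := hrec (i + 2) hi
      have f0 := ih i (by omega) (by omega)
      have f1 := ih (i + 1) (by omega) (by omega)
      simp only [lucasNum]
      simp only [add_assoc, Nat.reduceAdd] at e0 e1 f0 f1 ⊢
      linear_combination a₂ ^ (i + 1) * (y 0 * e1 - y 1 * e0) - a₁ * f1 - a₀ * a₂ * f0
  have hcop : IsCoprime (a₂ ^ N) (Int.gcd (a₀ ^ N) (lucasNum a₀ a₁ a₂ N) : ℤ) := by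
    refine isCoprime_of_prime_dvd (fun h => pow_ne_zero N ha2 h.1) fun p hp hp2 hpd => ?_
    have hN0 : N ≠ 0 := by
      rintro rfl
      exact hp.not_isUnit (isUnit_of_dvd_one (by simpa using hp2))
    have hpa2 : p ∣ a₂ := hp.dvd_of_dvd_pow hp2
    have hpa0 : p ∣ a₀ := hp.dvd_of_dvd_pow (hpd.trans (Int.gcd_dvd_left ..))
    have hpa1 : p ∣ a₁ := by
      have h1 : p ∣ lucasNum a₀ a₁ a₂ N := hpd.trans (Int.gcd_dvd_right ..)
      have h2 := hpa0.trans (dvd_lucasNum_sub a₀ a₁ a₂ N)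
      have h3 : p ∣ (-a₁) ^ N := by simpa using dvd_sub h1 h2
      exact (dvd_neg).1 (hp.dvd_of_dvd_pow h3)
    refine hp.not_isUnit (hP p ((C_dvd_iff_dvd_coeff _ _).2 fun i => ?_))
    rcases i with _ | _ | _ | i
    · exact hpa0
    · exact hpa1
    · exact hpa2
    · rw [coeff_eq_zero_of_natDegree_lt (by omega)]; exact dvd_zero _
  have hdvd : a₂ ^ N ∣ (Int.gcd (a₀ ^ N) (lucasNum a₀ a₁ a₂ N) : ℤ) * hankelTwo y 0 := by
    rw [Int.gcd_eq_gcd_ab]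
    refine ⟨Int.gcdA (a₀ ^ N) (lucasNum a₀ a₁ a₂ N) * hankelTwo y N
      + Int.gcdB (a₀ ^ N) (lucasNum a₀ a₁ a₂ N) * (y 0 * y (N + 2) - y 1 * y (N + 1)), ?_⟩
    have e0 := hpow N le_rfl
    have e1 := hM N le_rfl
    linear_combination (-Int.gcdA (a₀ ^ N) (lucasNum a₀ a₁ a₂ N)) * e0
      - Int.gcdB (a₀ ^ N) (lucasNum a₀ a₁ a₂ N) * e1
  obtain ⟨c, hc⟩ := hcop.dvd_of_dvd_mul_left hdvd
  refine ⟨c, hc, mul_left_cancel₀ (pow_ne_zero N ha2) ?_⟩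
  rw [hpow N le_rfl, hc]; ring

/-- The height of a primitive recurrence satisfied by a nongeometric approximation is bounded by
a small power of `X`, and its polynomial is small at `ζ`. -/
lemma IsApprox.bounds_of_recurrence {N : ℕ} {ζ δ X Z : ℝ} {y : ℕ → ℤ}
    (h : IsApprox (N + 2) ζ δ X y) (hZ : 1 ≤ Z) (hζ : |ζ| ≤ Z) (hζ0 : ζ ≠ 0) (hδ : δ ≤ 1)
    (hδζ : 6 * δ ≤ |ζ|) (hX : 1 ≤ X) {P : ℤ[X]} (hP : P.IsPrimitive) (hdeg : P.natDegree ≤ 2)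
    (ha2 : P.coeff 2 ≠ 0) (h2 : hankelTwo y 0 ≠ 0)
    (hrec : ∀ k ≤ N, P.coeff 0 * y k + P.coeff 1 * y (k + 1) + P.coeff 2 * y (k + 2) = 0) :
    |aeval ζ P| ≤ 3 * height P * δ ∧
      height P ^ N ≤ (2 * (2 * Z ^ 2 / |ζ| + 1)) ^ N * (8 * Z ^ (N + 3)) * X := by
  have hval : aeval ζ P = P.coeff 2 * ζ ^ 2 + P.coeff 1 * ζ + P.coeff 0 := by
    conv_lhs => rw [eq_quadPoly_of_natDegree_le_two hdeg, aeval_quadPoly]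
  have hδ0 : 0 ≤ δ := (abs_nonneg _).trans (h.2.2 0 (Nat.zero_le _))
  have hζpos : 0 < |ζ| := abs_pos.2 hζ0
  have hy1 : (1 : ℝ) ≤ |(y 0 : ℝ)| := by exact_mod_cast Int.one_le_abs h.1
  have hH0 := height_nonneg P
  have hsmall : |aeval ζ P| ≤ 3 * height P * δ := by
    have e : ((P.coeff 0 * y 0 + P.coeff 1 * y 1 + P.coeff 2 * y 2 : ℤ) : ℝ) = 0 := by
      exact_mod_cast hrec 0 (Nat.zero_le _)
    push_cast at e
    have hmul : aeval ζ P * y 0 = P.coeff 0 * (ζ ^ 0 * y 0 - y 0)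
        + P.coeff 1 * (ζ ^ 1 * y 0 - y 1) + P.coeff 2 * (ζ ^ 2 * y 0 - y 2) := by
      rw [hval]; linear_combination e
    have hb : |aeval ζ P * y 0| ≤ 3 * height P * δ := by
      rw [hmul]
      refine (abs_add_three _ _ _).trans ?_
      simp only [abs_mul]
      have b0 := mul_le_mul (abs_coeff_le_height P 0) (h.2.2 0 (by omega)) (abs_nonneg _) hH0
      have b1 := mul_le_mul (abs_coeff_le_height P 1) (h.2.2 1 (by omega)) (abs_nonneg _) hH0
      have b2 := mul_le_mul (abs_coeff_le_height P 2) (h.2.2 2 (by omega)) (abs_nonneg _) hH0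
      linarith
    rw [abs_mul] at hb
    nlinarith [abs_nonneg (aeval ζ P)]
  refine ⟨hsmall, ?_⟩
  obtain ⟨c, hc0, hcN⟩ := exists_hankelTwo_eq_pow_mul hP hdeg ha2 hrec
  have hc : (1 : ℝ) ≤ |(c : ℝ)| := by
    have : c ≠ 0 := by rintro rfl; exact h2 (by rw [hc0, mul_zero])
    exact_mod_cast Int.one_le_abs this
  have hminor (i : ℕ) (hi : i ≤ N) : |(hankelTwo y i : ℝ)| ≤ 8 * Z ^ (N + 3) * X := by
    have h1 := h.abs_minor_two_le hZ hζ hδ hX (i := i) (j := i + 1) (by omega) (by omega)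
    refine h1.trans ?_
    have : X * δ ≤ X := mul_le_of_le_one_right (by linarith) hδ
    gcongr
  have hout (a : ℤ) (i : ℕ) (hi : i ≤ N) (ha : hankelTwo y i = a ^ N * c) :
      |(a : ℝ)| ^ N ≤ 8 * Z ^ (N + 3) * X := by
    refine le_trans ?_ (hminor i hi)
    rw [ha]
    push_cast
    rw [abs_mul, abs_pow]
    exact le_mul_of_one_le_right (by positivity) hc
  have h0N := hout _ N le_rfl hcN
  have h2N := hout _ 0 (Nat.zero_le _) hc0
  set A := max |(P.coeff 0 : ℝ)| |(P.coeff 2 : ℝ)| with hA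
  have hA0 : 0 ≤ A := (abs_nonneg _).trans (le_max_left _ _)
  have hAN : A ^ N ≤ 8 * Z ^ (N + 3) * X := by
    rcases max_choice |(P.coeff 0 : ℝ)| |(P.coeff 2 : ℝ)| with hm | hm <;> rw [hA, hm] <;> assumption
  set κ := 2 * Z ^ 2 / |ζ| with hκ
  have hκ0 : 0 ≤ κ := by positivity
  -- the middle coefficient is controlled by the outer ones, since `P` is small at `ζ ≠ 0`
  have hmid : |(P.coeff 1 : ℝ)| ≤ height P / 2 + κ * A := by
    have e : (P.coeff 1 : ℝ) * ζ = aeval ζ P - P.coeff 0 - P.coeff 2 * ζ ^ 2 := by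
      rw [hval]; ring
    have h4 : |(P.coeff 1 : ℝ)| * |ζ| ≤ 3 * height P * δ + A + A * Z ^ 2 := by
      rw [← abs_mul, e]
      refine (abs_sub _ _).trans (add_le_add ((abs_sub _ _).trans
        (add_le_add hsmall (le_max_left _ _))) ?_)
      rw [abs_mul, abs_pow]
      gcongr
      exact le_max_right _ _
    have h5 : κ * |ζ| = 2 * Z ^ 2 := by rw [hκ]; field_simp
    have h6 : |(P.coeff 1 : ℝ)| * |ζ| ≤ (height P / 2 + κ * A) * |ζ| := by
      have h7 : (height P / 2 + κ * A) * |ζ| = height P / 2 * |ζ| + A * (κ * |ζ|) := by ring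
      rw [h7, h5]
      nlinarith [mul_nonneg hA0 (show 0 ≤ Z ^ 2 - 1 by nlinarith)]
    exact le_of_mul_le_mul_right h6 hζpos
  have hH : height P ≤ height P / 2 + (κ + 1) * A := by
    refine height_le_of_abs_coeff_le fun i => ?_
    have hκA := mul_nonneg hκ0 hA0
    rcases i with _ | _ | _ | i
    · have : |(P.coeff 0 : ℝ)| ≤ A := le_max_left _ _
      linarith
    · rw [zero_add]; linarith
    · have : |(P.coeff 2 : ℝ)| ≤ A := le_max_right _ _
      simp only [zero_add, Nat.reduceAdd]
      linarith
    · rw [coeff_eq_zero_of_natDegree_lt (by omega)]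
      simp only [Int.cast_zero, abs_zero]
      positivity
  have hHA : height P ≤ 2 * (κ + 1) * A := by linarith
  calc height P ^ N ≤ (2 * (κ + 1) * A) ^ N := by gcongr
    _ = (2 * (κ + 1)) ^ N * A ^ N := mul_pow _ _ _
    _ ≤ (2 * (κ + 1)) ^ N * (8 * Z ^ (N + 3) * X) := by gcongr
    _ = _ := by ring

/-- An approximation of quality above `1/2` yields an integer polynomial of degree at most two
which is small at `ζ` and whose height is a small power of `X`. -/
lemma exists_quadratic_of_half_lt {ζ l : ℝ} (hζ : Irrational ζ) {N : ℕ} (hN : 1 ≤ N)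
    (hl : 1 / 2 < l) : ∃ C > 0, ∃ X₀ : ℝ, ∀ X ≥ X₀, ∀ y, IsApprox (N + 2) ζ (X ^ (-l)) X y →
      ∃ P : ℤ[X], P ≠ 0 ∧ P.natDegree ≤ 2 ∧ height P ^ N ≤ C * X ∧
        |aeval ζ P| ≤ 3 * height P * X ^ (-(1 / 2) : ℝ) := by
  have hζ0 : ζ ≠ 0 := hζ.ne_zero
  set Z := max 1 |ζ|
  have hZ1 : 1 ≤ Z := le_max_left _ _
  have hζZ : |ζ| ≤ Z := le_max_right _ _
  have ht1 := tendsto_rpow_neg_atTop (show 0 < l by linarith)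
  have ht2 := tendsto_rpow_neg_atTop (show 0 < 2 * l - 1 by linarith)
  obtain ⟨X₀, hX₀⟩ := eventually_atTop.1
    (((ht1.eventually_lt_const (show 0 < |ζ| / 6 by positivity)).and
      (ht1.eventually_lt_const one_pos)).and
      (ht2.eventually_lt_const (show 0 < 1 / (48 * Z ^ (N + 4)) by positivity)))
  refine ⟨max ((2 * (2 * Z ^ 2 / |ζ| + 1)) ^ N * (8 * Z ^ (N + 3))) ((Z + 1) ^ N),
    lt_max_of_lt_right (by positivity), max X₀ 1, fun X hX y hy => ?_⟩
  obtain ⟨⟨hδζ, hδ1⟩, hXm⟩ := hX₀ X ((le_max_left _ _).trans hX)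
  have hX1 : 1 ≤ X := (le_max_right _ _).trans hX
  have hX0 : 0 < X := by linarith
  have hδhalf : X ^ (-l) ≤ X ^ (-(1 / 2) : ℝ) :=
    Real.rpow_le_rpow_of_exponent_le hX1 (by linarith)
  have h3 : ∀ j k, j ≤ N → k ≤ N → hankelThree y 0 j k = 0 := by
    intro j k hj hk
    have h1 := hy.abs_hankelThree_le hZ1 hζZ hδ1.le hX1 (i := 0) (j := j) (k := k)
      (by omega) (by omega) (by omega)
    have h2 : X * (X ^ (-l)) ^ 2 = X ^ (-(2 * l - 1)) := by
      rw [← Real.rpow_natCast, ← Real.rpow_mul hX0.le, ← Real.rpow_one_add' hX0.le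
        (by push_cast; linarith)]
      push_cast; ring_nf
    rw [h2] at h1
    rw [lt_div_iff₀ (by positivity)] at hXm
    have h3 : |(hankelThree y 0 j k : ℝ)| < 1 := by
      rw [show N + 2 + 2 = N + 4 by ring] at h1; linarith
    have h4 : |hankelThree y 0 j k| < 1 := by exact_mod_cast h3
    rwa [Int.abs_lt_one_iff] at h4
  by_cases h2 : hankelTwo y 0 = 0
  · obtain ⟨q, p, hq, hqX, hqp⟩ := (hy.mono (show N + 1 ≤ N + 2 by omega)).exists_linear_of_geometric
      (by omega) (geometric_of_hankelTwo_eq_zero h3 h2)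
    have hq1 : (1 : ℝ) ≤ q := by exact_mod_cast hq
    have hq0 : (0 : ℝ) < q := by linarith
    have hle : |q * ζ - p| ≤ X ^ (-l) :=
      le_trans (le_mul_of_one_le_left (abs_nonneg _) (one_le_pow₀ hq1)) hqp
    have hne : linPoly q p ≠ 0 := ne_zero_of_abs_aeval_pos (ζ := ζ) (by
      rw [aeval_linPoly]; exact abs_mul_sub_pos hζ hq.ne' p)
    have hH1 := one_le_height hne
    refine ⟨linPoly q p, hne, (natDegree_linPoly_le q p).trans one_le_two, ?_, ?_⟩
    · have hH : height (linPoly q p) ≤ (Z + 1) * q := by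
        refine height_linPoly_le ?_ ?_
        · rw [abs_of_pos hq0]; nlinarith
        · calc |(p : ℝ)| = |q * ζ - (q * ζ - p)| := by ring_nf
            _ ≤ |q * ζ| + |q * ζ - p| := abs_sub _ _
            _ ≤ q * Z + 1 := by
                rw [abs_mul, abs_of_pos hq0]
                gcongr
                exact hle.trans hδ1.le
            _ ≤ _ := by nlinarith
      calc height (linPoly q p) ^ N ≤ ((Z + 1) * q) ^ N := by gcongr
        _ = (Z + 1) ^ N * q ^ N := mul_pow _ _ _
        _ ≤ (Z + 1) ^ N * q ^ (N + 1) := by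
            have : (q : ℝ) ^ N ≤ q ^ (N + 1) := pow_le_pow_right₀ hq1 (by omega)
            gcongr
        _ ≤ (Z + 1) ^ N * X := by gcongr
        _ ≤ _ := by gcongr; exact le_max_right _ _
    · rw [aeval_linPoly]
      have hXp : 0 ≤ X ^ (-(1 / 2) : ℝ) := Real.rpow_nonneg hX0.le _
      nlinarith [hle.trans hδhalf]
  · obtain ⟨P, hP, hdeg, ha2, hrec⟩ := exists_primitive_recurrence hN h3 h2
    obtain ⟨b1, b2⟩ := hy.bounds_of_recurrence hZ1 hζZ hζ0 hδ1.le (by linarith) hX1 hP hdeg ha2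
      h2 hrec
    have hH0 := height_nonneg P
    refine ⟨P, hP.ne_zero, hdeg, b2.trans ?_, b1.trans ?_⟩
    · gcongr; exact le_max_left _ _
    · gcongr

/-- If all `λ_n` exceed `1/2`, then `w_2` is infinite: the height of the polynomial provided by
`exists_quadratic_of_half_lt` is at most about `X^{1/N}`, and `N` is arbitrary. -/
lemma wExp_two_eq_top_of_half_lt {ζ : ℝ} (hζ : Irrational ζ)
    (hquad : ∀ P : ℤ[X], P ≠ 0 → P.natDegree ≤ 2 → aeval ζ P ≠ 0)
    (h : ∀ n : ℕ, 1 ≤ n → ((1 / 2 : ℝ) : EReal) < lambdaExp n ζ) : wExp 2 ζ = ⊤ := by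
  suffices hW : ∀ W : ℝ, (W : EReal) ≤ wExp 2 ζ by
    rw [EReal.eq_top_iff_forall_lt]
    exact fun W => lt_of_lt_of_le (EReal.coe_lt_coe_iff.2 (lt_add_one W)) (hW (W + 1))
  intro W
  obtain ⟨N, hN⟩ := exists_nat_ge (max 4 (2 * W + 2))
  have hN4 : 4 ≤ N := by exact_mod_cast (le_max_left _ _).trans hN
  have hNW : 2 * W + 2 ≤ N := (le_max_right _ _).trans hN
  obtain ⟨l, hl1, hl2⟩ := EReal.lt_iff_exists_real_btwn.1 (h (N + 2) (by omega))
  obtain ⟨C, hC, X₀, hX₀⟩ := exists_quadratic_of_half_lt (N := N) hζ (by omega)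
    (EReal.coe_lt_coe_iff.1 hl1)
  refine le_wExp_of_small (C := 3 * C ^ (1 / 2 : ℝ)) fun ε hε => ?_
  have ht := tendsto_rpow_neg_atTop (show (0 : ℝ) < 1 / 4 by norm_num)
  obtain ⟨X₁, hX₁⟩ := eventually_atTop.1 (ht.eventually_lt_const
    (show 0 < ε / (3 * C ^ (1 / 4 : ℝ)) by positivity))
  obtain ⟨X, hX, hX1, y, hy⟩ := exists_isApprox_of_lt hl2 (max X₀ X₁)
  have hX0 : 0 < X := by linarith
  obtain ⟨P, hP0, hdeg, hH, hle⟩ := hX₀ X ((le_max_left _ _).trans hX) y hy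
  have hXε := hX₁ X ((le_max_right _ _).trans hX)
  rw [lt_div_iff₀ (by positivity)] at hXε
  have hH1 := one_le_height hP0
  have hHpos : 0 < height P := by linarith
  refine ⟨P, hdeg, abs_pos.2 (hquad P hP0 hdeg), lt_of_le_of_lt ?_ hXε, hle.trans ?_⟩
  · have h4 : height P ≤ (C * X) ^ (1 / 4 : ℝ) := by
      have h5 : height P ^ 4 ≤ C * X := (pow_le_pow_right₀ hH1 hN4).trans hH
      calc height P = (height P ^ 4) ^ (1 / 4 : ℝ) := by
            rw [← Real.rpow_natCast, ← Real.rpow_mul hHpos.le]; norm_num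
        _ ≤ _ := by gcongr
    calc |aeval ζ P| ≤ 3 * height P * X ^ (-(1 / 2) : ℝ) := hle
      _ ≤ 3 * (C * X) ^ (1 / 4 : ℝ) * X ^ (-(1 / 2) : ℝ) := by gcongr
      _ = X ^ (-(1 / 4) : ℝ) * (3 * C ^ (1 / 4 : ℝ)) := by
          rw [Real.mul_rpow hC.le hX0.le, show (-(1 / 4) : ℝ) = 1 / 4 + -(1 / 2) by norm_num,
            Real.rpow_add hX0]
          ring
  · have h4 : X ^ (-(1 / 2) : ℝ) ≤ C ^ (1 / 2 : ℝ) * height P ^ (-(N / 2 : ℝ)) := by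
      have h5 : X ^ (-(1 / 2) : ℝ) ≤ (height P ^ N / C) ^ (-(1 / 2) : ℝ) := by
        refine Real.rpow_le_rpow_of_nonpos (by positivity) ?_ (by norm_num)
        rw [div_le_iff₀ hC]; linarith
      refine h5.trans (le_of_eq ?_)
      rw [Real.div_rpow (by positivity) hC.le, ← Real.rpow_natCast, ← Real.rpow_mul hHpos.le,
        Real.rpow_neg hC.le, div_inv_eq_mul, mul_comm]
      ring_nf
    calc 3 * height P * X ^ (-(1 / 2) : ℝ)
        ≤ 3 * height P * (C ^ (1 / 2 : ℝ) * height P ^ (-(N / 2 : ℝ))) := by gcongr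
      _ = 3 * C ^ (1 / 2 : ℝ) * height P ^ (1 + -(N / 2 : ℝ)) := by
          rw [Real.rpow_add hHpos, Real.rpow_one]; ring
      _ ≤ 3 * C ^ (1 / 2 : ℝ) * height P ^ (-W) := by
          have : height P ^ (1 + -(N / 2 : ℝ)) ≤ height P ^ (-W) :=
            Real.rpow_le_rpow_of_exponent_le hH1 (by linarith)
          gcongr

/-! ### Continued fractions with prescribed growth -/

/-- Two consecutive convergents `p' / q'`, `p / q` of a continued fraction, and the threshold `T`
which the denominator has to reach before the next large partial quotient. -/
structure CFState where
  p' : ℤ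
  p : ℤ
  q' : ℕ
  q : ℕ
  T : ℕ

/-- The large partial quotient used after the denominator `q`: its size `q^{w-1}` makes the
convergent an approximation of order `w`, and the logarithmic term makes the partial quotients
unbounded even for `w = 1`. -/
def largeQuotient (w : ℝ) (q : ℕ) : ℕ := ⌊(q : ℝ) ^ (w - 1)⌋₊ + Nat.log 2 q

/-- One step of the continued fraction: the partial quotient is `1` until the denominator reaches
the threshold; then it is large, and the threshold is reset to a huge power of the new
denominator. -/
def CFState.step (w : ℝ) (s : CFState) : CFState :=
  if s.T ≤ s.q then
    { p' := s.p
      p := largeQuotient w s.q * s.p + s.p'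
      q' := s.q
      q := largeQuotient w s.q * s.q + s.q'
      T := (largeQuotient w s.q * s.q + s.q') ^ Nat.log 2 (largeQuotient w s.q * s.q + s.q') }
  else
    { p' := s.p
      p := s.p + s.p'
      q' := s.q
      q := s.q + s.q'
      T := s.T }

/-- The numerators `p` and denominators `q` of a continued fraction with positive partial quotients
`a`, started at `0 / 1, 1 / 2`. -/
structure IsCF (a q : ℕ → ℕ) (p : ℕ → ℤ) : Prop where
  one_le (k : ℕ) : 1 ≤ a k
  q_zero : q 0 = 1
  q_one : q 1 = 2
  p_zero : p 0 = 0
  p_one : p 1 = 1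
  q_rec (k : ℕ) : q (k + 2) = a k * q (k + 1) + q k
  p_rec (k : ℕ) : p (k + 2) = a k * p (k + 1) + p k

namespace IsCF

variable {a q : ℕ → ℕ} {p : ℕ → ℤ}

lemma q_pos (h : IsCF a q p) : ∀ k, 0 < q k
  | 0 => by rw [h.q_zero]; norm_num
  | 1 => by rw [h.q_one]; norm_num
  | k + 2 => by rw [h.q_rec]; have := h.q_pos k; omega

lemma strictMono (h : IsCF a q p) : StrictMono q := by
  refine strictMono_nat_of_lt_succ fun k => ?_
  rcases k with _ | k
  · rw [h.q_zero, zero_add, h.q_one]; norm_num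
  · rw [h.q_rec]
    have h1 := h.q_pos k
    have h2 := Nat.mul_le_mul_right (q (k + 1)) (h.one_le k)
    omega

lemma le_q (h : IsCF a q p) (k : ℕ) : k ≤ q k := h.strictMono.le_apply

lemma det (h : IsCF a q p) (k : ℕ) : p (k + 1) * q k - p k * q (k + 1) = (-1) ^ k := by
  induction k with
  | zero => simp [h.q_zero, h.p_zero, h.p_one]
  | succ k ih =>
    rw [h.q_rec, h.p_rec, pow_succ, ← ih]
    push_cast
    ring

lemma p_nonneg (h : IsCF a q p) : ∀ k, 0 ≤ p k
  | 0 => h.p_zero.ge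
  | 1 => by rw [h.p_one]; norm_num
  | k + 2 => by
    rw [h.p_rec]
    have := h.p_nonneg k
    have := h.p_nonneg (k + 1)
    positivity

lemma p_le_q (h : IsCF a q p) : ∀ k, p k ≤ q k
  | 0 => by rw [h.p_zero]; positivity
  | 1 => by rw [h.p_one, h.q_one]; norm_num
  | k + 2 => by
    rw [h.p_rec, h.q_rec]
    have := h.p_le_q k
    have := h.p_le_q (k + 1)
    push_cast
    gcongr

/-- The intervals bounded by consecutive convergents are nested; a common point is approximated
by all convergents. -/
lemma exists_limit (h : IsCF a q p) :
    ∃ ζ : ℝ, ∀ k, |q k * ζ - p k| ≤ 1 / (q (k + 1) : ℝ) := by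
  have hq (k : ℕ) : (0 : ℝ) < q k := by exact_mod_cast h.q_pos k
  set x : ℕ → ℝ := fun k => p k / q k with hx
  set I : ℕ → Set ℝ := fun k => Set.uIcc (x k) (x (k + 1)) with hI
  have hmem (k : ℕ) : x (k + 2) ∈ I k := by
    simp only [hI]
    rw [← segment_eq_uIcc]
    have hpos := hq (k + 2)
    refine ⟨q k / q (k + 2), a k * q (k + 1) / q (k + 2), by positivity, by positivity, ?_, ?_⟩
    · rw [← add_div, div_eq_one_iff_eq hpos.ne', h.q_rec]; push_cast; ring
    · have h1 := (hq k).ne'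
      have h2 := (hq (k + 1)).ne'
      simp only [hx, smul_eq_mul]
      rw [h.p_rec]
      push_cast
      field_simp
      ring
  obtain ⟨ζ, hζ⟩ := IsCompact.nonempty_iInter_of_sequence_nonempty_isCompact_isClosed I
    (fun k => Set.uIcc_subset_uIcc Set.right_mem_uIcc (hmem k)) (fun _ => Set.nonempty_uIcc)
    isCompact_uIcc (fun _ => isCompact_uIcc.isClosed)
  refine ⟨ζ, fun k => ?_⟩
  have h1 := Set.abs_sub_left_of_mem_uIcc (Set.mem_iInter.1 hζ k)
  have h2 : |x (k + 1) - x k| = 1 / (q k * q (k + 1)) := by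
    have hd : x (k + 1) - x k = (-1) ^ k / (q k * q (k + 1)) := by
      have h3 : (p (k + 1) : ℝ) * q k - p k * q (k + 1) = (-1) ^ k := by exact_mod_cast h.det k
      rw [← h3]
      simp only [hx]
      have h1 := (hq k).ne'
      have h2 := (hq (k + 1)).ne'
      field_simp
    rw [hd, abs_div, abs_pow, abs_neg, abs_one, one_pow,
      abs_of_pos (mul_pos (hq k) (hq (k + 1)))]
  rw [h2] at h1
  have h3 : q k * ζ - p k = q k * (ζ - x k) := by
    simp only [hx]
    have h1 := (hq k).ne'
    field_simp
  rw [h3, abs_mul, abs_of_pos (hq k)]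
  calc (q k : ℝ) * |ζ - x k| ≤ q k * (1 / (q k * q (k + 1))) := by gcongr
    _ = _ := by have h1 := (hq k).ne'; field_simp

variable {ζ : ℝ}

lemma one_div_le_abs (h : IsCF a q p) (hζ : ∀ k, |q k * ζ - p k| ≤ 1 / (q (k + 1) : ℝ)) (k : ℕ) :
    1 / (2 * q (k + 1) : ℝ) ≤ |q k * ζ - p k| := by
  have hq (k : ℕ) : (0 : ℝ) < q k := by exact_mod_cast h.q_pos k
  have h3 : (p (k + 1) : ℝ) * q k - p k * q (k + 1) = (-1) ^ k := by exact_mod_cast h.det k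
  have h4 : (1 : ℝ) ≤ q (k + 1) * |q k * ζ - p k| + q k * |q (k + 1) * ζ - p (k + 1)| := by
    calc (1 : ℝ) = |q (k + 1) * (q k * ζ - p k) - q k * (q (k + 1) * ζ - p (k + 1))| := by
          rw [show q (k + 1) * (q k * ζ - p k) - q k * (q (k + 1) * ζ - p (k + 1))
            = (p (k + 1) : ℝ) * q k - p k * q (k + 1) by ring, h3]
          simp
      _ ≤ _ := by
          refine (abs_sub _ _).trans ?_
          rw [abs_mul, abs_mul, abs_of_pos (hq _), abs_of_pos (hq _)]
  have h5 : 2 * q k ≤ q (k + 2) := by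
    rw [h.q_rec]
    have h1 := Nat.mul_le_mul_right (q (k + 1)) (h.one_le k)
    have h2 := h.strictMono (show k < k + 1 by omega)
    omega
  have h5' : 2 * (q k : ℝ) ≤ q (k + 2) := by exact_mod_cast h5
  have h6 : (q k : ℝ) * |q (k + 1) * ζ - p (k + 1)| ≤ 1 / 2 := by
    calc (q k : ℝ) * |q (k + 1) * ζ - p (k + 1)| ≤ q k * (1 / q (k + 2)) := by
          gcongr
          exact hζ (k + 1)
      _ ≤ 1 / 2 := by
          rw [mul_one_div, div_le_div_iff₀ (hq _) two_pos]; linarith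
  rw [div_le_iff₀ (mul_pos two_pos (hq _))]
  linarith

/-- A fraction with denominator `u`, where `q_{k+1} ≤ 2 u < q_{k+2}`, is up to a constant no better
an approximation than the convergent with denominator `q_{k+1}`. -/
lemma exists_one_div_le_abs (h : IsCF a q p) (hζ : ∀ k, |q k * ζ - p k| ≤ 1 / (q (k + 1) : ℝ))
    (u v : ℤ) (hu : 0 < u) :
    ∃ k, (q (k + 1) : ℝ) ≤ 2 * u ∧ 1 / (4 * q (k + 2) : ℝ) ≤ |u * ζ - v| := by
  have hq (k : ℕ) : (0 : ℝ) < q k := by exact_mod_cast h.q_pos k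
  obtain ⟨k, hk1, hk2⟩ : ∃ k, (q (k + 1) : ℤ) ≤ 2 * u ∧ 2 * u < q (k + 2) := by
    have hex : ∃ m, 2 * u < q (m + 2) :=
      ⟨(2 * u).toNat, by have := h.le_q ((2 * u).toNat + 2); omega⟩
    refine ⟨Nat.find hex, ?_, Nat.find_spec hex⟩
    rcases hf : Nat.find hex with _ | m
    · rw [zero_add, h.q_one]; push_cast; omega
    · have := Nat.find_min hex (m := m) (by omega)
      exact not_lt.1 this
  have hk1' : (q (k + 1) : ℝ) ≤ 2 * u := by exact_mod_cast hk1
  have hk2' : 2 * (u : ℝ) < q (k + 2) := by exact_mod_cast hk2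
  have hu0 : (0 : ℝ) < u := by exact_mod_cast hu
  have hqq : (q (k + 1) : ℝ) ≤ q (k + 2) := by exact_mod_cast h.strictMono.monotone (by omega)
  have hB := h.one_div_le_abs hζ (k + 1)
  have hB' := hζ (k + 1)
  refine ⟨k, hk1', ?_⟩
  by_cases heq : u * p (k + 1) = v * q (k + 1)
  · have heq' : (u : ℝ) * p (k + 1) = v * q (k + 1) := by exact_mod_cast heq
    have h1 : u * |q (k + 1) * ζ - p (k + 1)| = q (k + 1) * |u * ζ - v| := by
      calc u * |q (k + 1) * ζ - p (k + 1)| = |u * (q (k + 1) * ζ - p (k + 1))| := by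
            rw [abs_mul, abs_of_pos hu0]
        _ = |q (k + 1) * (u * ζ - v)| := by congr 1; linear_combination -heq'
        _ = _ := by rw [abs_mul, abs_of_pos (hq _)]
    have h2 : (q (k + 1) : ℝ) * (1 / (4 * q (k + 2))) ≤ q (k + 1) * |u * ζ - v| := by
      rw [← h1]
      calc (q (k + 1) : ℝ) * (1 / (4 * q (k + 2))) = (q (k + 1) / 2) * (1 / (2 * q (k + 2))) := by
            have := (hq (k + 2)).ne'
            field_simp
            norm_num
        _ ≤ u * |q (k + 1) * ζ - p (k + 1)| := by
            have := hq (k + 2)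
            gcongr
            linarith
    exact le_of_mul_le_mul_left h2 (hq _)
  · have h1 : (1 : ℝ) ≤ |(u : ℝ) * p (k + 1) - v * q (k + 1)| := by
      exact_mod_cast Int.one_le_abs (sub_ne_zero.2 heq)
    have h2 : |(u : ℝ) * p (k + 1) - v * q (k + 1)| ≤
        q (k + 1) * |u * ζ - v| + u * |q (k + 1) * ζ - p (k + 1)| := by
      calc _ = |q (k + 1) * (u * ζ - v) - u * (q (k + 1) * ζ - p (k + 1))| := by ring_nf
        _ ≤ |q (k + 1) * (u * ζ - v)| + |u * (q (k + 1) * ζ - p (k + 1))| := abs_sub _ _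
        _ = _ := by rw [abs_mul, abs_mul, abs_of_pos (hq _), abs_of_pos hu0]
    have h3 : u * |q (k + 1) * ζ - p (k + 1)| ≤ 1 / 2 := by
      calc u * |q (k + 1) * ζ - p (k + 1)| ≤ u * (1 / q (k + 2)) := by gcongr
        _ ≤ 1 / 2 := by rw [mul_one_div, div_le_div_iff₀ (hq _) two_pos]; linarith
    have h4 : (q (k + 1) : ℝ) * |u * ζ - v| ≤ q (k + 2) * |u * ζ - v| := by gcongr
    have := hq (k + 2)
    rw [div_le_iff₀ (by positivity)]
    linarith

lemma irrational (h : IsCF a q p) (hζ : ∀ k, |q k * ζ - p k| ≤ 1 / (q (k + 1) : ℝ)) :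
    Irrational ζ := by
  rintro ⟨r, rfl⟩
  obtain ⟨k, -, hk⟩ := h.exists_one_div_le_abs hζ r.den r.num (by exact_mod_cast r.pos)
  have h1 : ((r.den : ℤ) : ℝ) * (r : ℝ) = r.num := by exact_mod_cast Rat.den_mul_eq_num r
  rw [h1, sub_self, abs_zero] at hk
  have : (0 : ℝ) < q (k + 2) := by exact_mod_cast h.q_pos (k + 2)
  have : (0 : ℝ) < 1 / (4 * q (k + 2)) := by positivity
  linarith

/-- The quadratic polynomial `(q_k T - p_k)² + (q_k T - p_k)(q_{k+1} T - p_{k+1}) -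
(q_{k+1} T - p_{k+1})²`, whose root is the continued fraction continued by ones. -/
def goldenPoly (q : ℕ → ℕ) (p : ℕ → ℤ) (k : ℕ) : ℤ[X] :=
  quadPoly (q k ^ 2 + q k * q (k + 1) - q (k + 1) ^ 2)
    (-(2 * p k * q k + p k * q (k + 1) + q k * p (k + 1) - 2 * p (k + 1) * q (k + 1)))
    (p k ^ 2 + p k * p (k + 1) - p (k + 1) ^ 2)

lemma aeval_goldenPoly (q : ℕ → ℕ) (p : ℕ → ℤ) (k : ℕ) (ζ : ℝ) :
    aeval ζ (goldenPoly q p k) = (q k * ζ - p k) ^ 2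
      + (q k * ζ - p k) * (q (k + 1) * ζ - p (k + 1)) - (q (k + 1) * ζ - p (k + 1)) ^ 2 := by
  rw [goldenPoly, aeval_quadPoly]
  push_cast
  ring

lemma goldenPoly_ne_zero (h : IsCF a q p) (k : ℕ) : goldenPoly q p k ≠ 0 := by
  intro h0
  have e2 := congrArg (fun P => coeff P 2) h0
  have e1 := congrArg (fun P => coeff P 1) h0
  have e0 := congrArg (fun P => coeff P 0) h0
  simp only [goldenPoly, coeff_two_quadPoly, coeff_one_quadPoly, coeff_zero_quadPoly,
    coeff_zero] at e0 e1 e2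
  have hd := h.det k
  have hd2 : (p (k + 1) * q k - p k * q (k + 1)) ^ 2 = 1 := by
    rw [hd, ← pow_mul, mul_comm, pow_mul]; simp
  -- the discriminant is `5`
  have h5 : (5 : ℤ) = 0 := by
    linear_combination (-5) * hd2 + (-(2 * p k * q k + p k * q (k + 1) + q k * p (k + 1)
      - 2 * p (k + 1) * q (k + 1))) * e1 - 4 * (p k ^ 2 + p k * p (k + 1) - p (k + 1) ^ 2) * e2
  norm_num at h5

lemma height_goldenPoly_le (h : IsCF a q p) (k : ℕ) :
    height (goldenPoly q p k) ≤ 6 * (q (k + 1) : ℝ) ^ 2 := by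
  have hp0 : (0 : ℝ) ≤ p k := by exact_mod_cast h.p_nonneg k
  have hp1 : (0 : ℝ) ≤ p (k + 1) := by exact_mod_cast h.p_nonneg (k + 1)
  have hq : (q k : ℝ) ≤ q (k + 1) := by exact_mod_cast h.strictMono.monotone (by omega)
  have hq0 : (0 : ℝ) ≤ q k := by positivity
  have hpq : (p k : ℝ) ≤ q (k + 1) := le_trans (by exact_mod_cast h.p_le_q k) hq
  have hpq1 : (p (k + 1) : ℝ) ≤ q (k + 1) := by exact_mod_cast h.p_le_q (k + 1)
  have hm : ∀ x y : ℝ, 0 ≤ x → 0 ≤ y → x ≤ q (k + 1) → y ≤ q (k + 1) →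
      0 ≤ x * y ∧ x * y ≤ (q (k + 1) : ℝ) ^ 2 := fun x y hx hy hx' hy' =>
    ⟨mul_nonneg hx hy, by rw [sq]; exact mul_le_mul hx' hy' hy (hx.trans hx')⟩
  have hQ0 : (0 : ℝ) ≤ q (k + 1) := hq0.trans hq
  refine height_quadPoly_le ?_ ?_ ?_
  · push_cast
    have t1 := hm _ _ hq0 hq0 hq hq
    have t2 := hm _ _ hq0 hQ0 hq le_rfl
    rw [abs_le]
    constructor <;> linarith [t1.1, t1.2, t2.1, t2.2, sq (q k : ℝ), sq_nonneg (q (k + 1) : ℝ)]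
  · push_cast
    have t1 := hm _ _ hp0 hq0 hpq hq
    have t2 := hm _ _ hp0 hQ0 hpq le_rfl
    have t3 := hm _ _ hq0 hp1 hq hpq1
    have t4 := hm _ _ hp1 hQ0 hpq1 le_rfl
    rw [abs_le]
    constructor <;> linarith [t1.1, t1.2, t2.1, t2.2, t3.1, t3.2, t4.1, t4.2]
  · push_cast
    have t1 := hm _ _ hp0 hp0 hpq hpq
    have t2 := hm _ _ hp0 hp1 hpq hpq1
    have t3 := hm _ _ hp1 hp1 hpq1 hpq1
    rw [abs_le]
    constructor <;> linarith [t1.1, t1.2, t2.1, t2.2, t3.1, t3.2, sq (p k : ℝ),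
      sq (p (k + 1) : ℝ)]

lemma abs_aeval_goldenPoly_succ (h : IsCF a q p) {k : ℕ} (hk : a k = 1) (ζ : ℝ) :
    |aeval ζ (goldenPoly q p (k + 1))| = |aeval ζ (goldenPoly q p k)| := by
  rw [← abs_neg, aeval_goldenPoly, aeval_goldenPoly, h.q_rec, h.p_rec, hk]
  congr 1
  push_cast
  ring

/-- A block of partial quotients `1` preserves the golden polynomial up to sign, so that its value
at `ζ` is governed by the end of the block. -/
lemma abs_aeval_goldenPoly_le (h : IsCF a q p) (hζ : ∀ k, |q k * ζ - p k| ≤ 1 / (q (k + 1) : ℝ))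
    {s m : ℕ} (hsm : s ≤ m) (hone : ∀ i, s ≤ i → i < m → a i = 1) :
    |aeval ζ (goldenPoly q p s)| ≤ 3 / (q (m + 1) : ℝ) ^ 2 := by
  have hinv : |aeval ζ (goldenPoly q p m)| = |aeval ζ (goldenPoly q p s)| := by
    induction m, hsm using Nat.le_induction with
    | base => rfl
    | succ m hm ih =>
      rw [h.abs_aeval_goldenPoly_succ (hone m hm (Nat.lt_succ_self m))]
      exact ih fun i hi hi' => hone i hi (hi'.trans (Nat.lt_succ_self m))
  rw [← hinv, aeval_goldenPoly]
  have hq (k : ℕ) : (0 : ℝ) < q k := by exact_mod_cast h.q_pos k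
  have b0 := hζ m
  have b1 : |q (m + 1) * ζ - p (m + 1)| ≤ 1 / (q (m + 1) : ℝ) :=
    (hζ (m + 1)).trans (one_div_le_one_div_of_le (hq _)
      (by exact_mod_cast h.strictMono.monotone (by omega)))
  set t := 1 / (q (m + 1) : ℝ) with ht
  have ht0 : 0 ≤ t := (abs_nonneg _).trans b0
  have hfin : 3 / (q (m + 1) : ℝ) ^ 2 = t * t + t * t + t * t := by rw [ht]; ring
  rw [hfin]
  refine (abs_sub _ _).trans (add_le_add ((abs_add_le _ _).trans (add_le_add ?_ ?_)) ?_)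
  · rw [sq, abs_mul]; gcongr
  · rw [abs_mul]; gcongr
  · rw [sq, abs_mul]; gcongr

end IsCF

lemma one_le_largeQuotient (w : ℝ) {q : ℕ} (hq : 2 ≤ q) : 1 ≤ largeQuotient w q :=
  le_trans (Nat.log_pos one_lt_two hq) (Nat.le_add_left _ _)

/-- There is a continued fraction whose partial quotients are `1` except for large ones which
occur infinitely often and are separated by arbitrarily long blocks of ones. -/
lemma exists_isCF (w : ℝ) : ∃ (a q : ℕ → ℕ) (p : ℕ → ℤ), IsCF a q p ∧
    (∀ k, a k ≤ largeQuotient w (q (k + 1))) ∧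
    ∀ K, ∃ s m, K ≤ s ∧ s ≤ m ∧ (∀ i, s ≤ i → i < m → a i = 1) ∧
      a m = largeQuotient w (q (m + 1)) ∧ q (s + 1) ^ Nat.log 2 (q (s + 1)) ≤ q (m + 1) := by
  set st : ℕ → CFState := fun k => (CFState.step w)^[k] ⟨0, 1, 1, 2, 0⟩ with hst
  have hsucc (k : ℕ) : st (k + 1) = (st k).step w := Function.iterate_succ_apply' _ _ _
  set a : ℕ → ℕ := fun k => if (st k).T ≤ (st k).q then largeQuotient w (st k).q else 1 with ha
  have hq' (k : ℕ) : (st (k + 1)).q' = (st k).q := by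
    rw [hsucc, CFState.step]; split_ifs <;> rfl
  have hp' (k : ℕ) : (st (k + 1)).p' = (st k).p := by
    rw [hsucc, CFState.step]; split_ifs <;> rfl
  have hqr (k : ℕ) : (st (k + 1)).q = a k * (st k).q + (st k).q' := by
    rw [hsucc, CFState.step]; simp only [ha]; split_ifs <;> simp
  have hpr (k : ℕ) : (st (k + 1)).p = a k * (st k).p + (st k).p' := by
    rw [hsucc, CFState.step]; simp only [ha]; split_ifs <;> simp
  have hq2 : ∀ k, 2 ≤ (st k).q := by
    intro k
    induction k with
    | zero => rfl
    | succ k ih =>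
      rw [hqr]
      have h1 : 1 ≤ a k := by
        simp only [ha]; split_ifs
        · exact one_le_largeQuotient w ih
        · exact le_rfl
      have := Nat.mul_le_mul_right (st k).q h1
      omega
  have hcf : IsCF a (fun k => (st k).q') (fun k => (st k).p') :=
    { one_le := fun k => by
        simp only [ha]; split_ifs
        · exact one_le_largeQuotient w (hq2 k)
        · exact le_rfl
      q_zero := rfl
      q_one := hq' 0
      p_zero := rfl
      p_one := hp' 0
      q_rec := fun k => by rw [hq', hq', hqr]
      p_rec := fun k => by rw [hp', hp', hpr] }
  have hlarge (k : ℕ) (hk : (st k).T ≤ (st k).q) :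
      a k = largeQuotient w (st k).q ∧
        (st (k + 1)).T = (st (k + 1)).q ^ Nat.log 2 (st (k + 1)).q := by
    refine ⟨by simp only [ha, if_pos hk], ?_⟩
    rw [hsucc, CFState.step, if_pos hk]
  have hsmall (k : ℕ) (hk : ¬ (st k).T ≤ (st k).q) : a k = 1 ∧ (st (k + 1)).T = (st k).T := by
    refine ⟨by simp only [ha, if_neg hk], ?_⟩
    rw [hsucc, CFState.step, if_neg hk]
  -- without large partial quotients the threshold is constant
  have hconst (s m : ℕ) (hsm : s ≤ m) (hno : ∀ i, s ≤ i → i < m → ¬ (st i).T ≤ (st i).q) :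
      (st m).T = (st s).T := by
    induction m, hsm using Nat.le_induction with
    | base => rfl
    | succ m hm ih =>
      rw [(hsmall m (hno m hm (Nat.lt_succ_self m))).2]
      exact ih fun i hi hi' => hno i hi (hi'.trans (Nat.lt_succ_self m))
  have hex (K : ℕ) : ∃ k, K ≤ k ∧ (st k).T ≤ (st k).q := by
    by_contra! hcon
    have h1 := hconst K (max K (st K).T) (le_max_left _ _) fun i hi _ => not_le.2 (hcon i hi)
    have h2 := hcon (max K (st K).T) (le_max_left _ _)
    have h3 := hcf.le_q (max K (st K).T + 1)
    rw [h1] at h2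
    simp only [hq'] at h3
    omega
  refine ⟨a, fun k => (st k).q', fun k => (st k).p', hcf, fun k => ?_, fun K => ?_⟩
  · simp only [ha, hq']
    split_ifs
    · exact le_rfl
    · exact one_le_largeQuotient w (hq2 k)
  · obtain ⟨k, hKk, hk⟩ := hex K
    have hm := hex (k + 1)
    refine ⟨k + 1, Nat.find hm, by omega, (Nat.find_spec hm).1, fun i hi hi' => ?_, ?_, ?_⟩
    · exact (hsmall i fun hcon => Nat.find_min hm hi' ⟨hi, hcon⟩).1
    · simp only [hq']
      exact (hlarge _ (Nat.find_spec hm).2).1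
    · simp only [hq']
      rw [← (hlarge k hk).2, ← hconst (k + 1) (Nat.find hm) (Nat.find_spec hm).1
        fun i hi hi' hcon => Nat.find_min hm hi' ⟨hi, hcon⟩]
      exact (Nat.find_spec hm).2

lemma natLog_le_rpow {δ : ℝ} (hδ : 0 < δ) {q : ℕ} (hq : 1 ≤ q) :
    (Nat.log 2 q : ℝ) ≤ (q : ℝ) ^ δ / (δ * Real.log 2) := by
  have h2 : 0 < Real.log 2 := Real.log_pos one_lt_two
  have hq0 : (0 : ℝ) < q := by exact_mod_cast hq
  have h1 : (Nat.log 2 q : ℝ) * Real.log 2 ≤ Real.log q := by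
    rw [← Real.log_pow]
    refine Real.log_le_log (by positivity) ?_
    exact_mod_cast Nat.pow_log_le_self 2 (by omega)
  have h3 := Real.log_le_rpow_div hq0.le hδ
  rw [le_div_iff₀ (by positivity)]
  rw [le_div_iff₀ hδ] at h3
  nlinarith

namespace IsCF

variable {a q : ℕ → ℕ} {p : ℕ → ℤ} {ζ w : ℝ}

lemma mul_le_q (h : IsCF a q p) (k : ℕ) : (a k : ℝ) * q (k + 1) ≤ q (k + 2) := by
  rw [h.q_rec]
  push_cast
  linarith [show (0 : ℝ) ≤ q k by positivity]

lemma wExp_one_le (h : IsCF a q p) (hζ : ∀ k, |q k * ζ - p k| ≤ 1 / (q (k + 1) : ℝ))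
    (hw : 1 ≤ w) (hale : ∀ k, a k ≤ largeQuotient w (q (k + 1))) : wExp 1 ζ ≤ (w : EReal) := by
  have hq (k : ℕ) : (0 : ℝ) < q k := by exact_mod_cast h.q_pos k
  have hq1 (k : ℕ) : (1 : ℝ) ≤ q k := by exact_mod_cast h.q_pos k
  by_contra! hlt
  obtain ⟨r, hr1, hr2⟩ := EReal.lt_iff_exists_real_btwn.1 hlt
  have hδ : 0 < r - w := sub_pos.2 (EReal.coe_lt_coe_iff.1 hr1)
  set M := 1 / ((r - w) * Real.log 2) with hM
  have hl2 : 0 < Real.log 2 := Real.log_pos one_lt_two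
  have hM0 : 0 < M := by positivity
  have hgrow (k : ℕ) : (q (k + 2) : ℝ) ≤ (M + 2) * (q (k + 1) : ℝ) ^ r := by
    set Q := (q (k + 1) : ℝ) with hQ
    have hQ1 : 1 ≤ Q := hq1 _
    have hQ0 : 0 < Q := hq _
    have e1 : (a k : ℝ) ≤ Q ^ (w - 1) + Q ^ (r - w) * M := by
      have e2 : (a k : ℝ) ≤ (largeQuotient w (q (k + 1)) : ℝ) := by exact_mod_cast hale k
      refine e2.trans ?_
      rw [largeQuotient]
      push_cast
      have e3 := natLog_le_rpow hδ (show 1 ≤ q (k + 1) from h.q_pos _)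
      have e4 := Nat.floor_le (show 0 ≤ Q ^ (w - 1) by positivity)
      rw [hM, mul_one_div]
      exact add_le_add e4 e3
    have e5 : Q ^ (w - 1) ≤ Q ^ (r - 1) := Real.rpow_le_rpow_of_exponent_le hQ1 (by linarith)
    have e6 : Q ^ (r - w) ≤ Q ^ (r - 1) := Real.rpow_le_rpow_of_exponent_le hQ1 (by linarith)
    have e7 : 1 ≤ Q ^ (r - 1) := Real.one_le_rpow hQ1 (by linarith)
    have e8 : Q ^ r = Q ^ (r - 1) * Q := by
      rw [← Real.rpow_add_one hQ0.ne']; ring_nf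
    have e9 : (q k : ℝ) ≤ Q := by
      rw [hQ]
      exact_mod_cast h.strictMono.monotone (show k ≤ k + 1 by omega)
    rw [h.q_rec, e8]
    push_cast
    calc (a k : ℝ) * Q + q k ≤ (Q ^ (r - 1) + Q ^ (r - 1) * M) * Q + Q ^ (r - 1) * Q := by
          gcongr
          · refine e1.trans ?_
            gcongr
          · nlinarith
      _ = _ := by ring
  have hr0 : 0 ≤ r := by linarith
  have := wExp_one_le_of_lower_bound (ζ := ζ) (s := r) (c := (4 * (M + 2) * 2 ^ r)⁻¹) hr0
    (by positivity) fun u v hu => by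
      obtain ⟨k, hk1, hk2⟩ := h.exists_one_div_le_abs hζ u v hu
      have hu0 : (0 : ℝ) < u := by exact_mod_cast hu
      refine le_trans ?_ hk2
      rw [Real.rpow_neg hu0.le, ← mul_inv, ← one_div]
      refine one_div_le_one_div_of_le (mul_pos (by norm_num) (hq _)) ?_
      calc 4 * (q (k + 2) : ℝ) ≤ 4 * ((M + 2) * (q (k + 1) : ℝ) ^ r) := by
            gcongr; exact hgrow k
        _ ≤ 4 * ((M + 2) * (2 * u) ^ r) := by
            gcongr
        _ = _ := by rw [Real.mul_rpow zero_le_two hu0.le]; ring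
  exact absurd hr2 (not_lt.2 this)

lemma le_wExp_one (h : IsCF a q p) (hζ : ∀ k, |q k * ζ - p k| ≤ 1 / (q (k + 1) : ℝ))
    (hw : 1 ≤ w) (hlarge : ∀ K, ∃ m, K ≤ m ∧ a m = largeQuotient w (q (m + 1))) :
    (w : EReal) ≤ wExp 1 ζ := by
  have hirr := h.irrational hζ
  have hklt (k : ℕ) : (k : ℝ) ≤ q k := by exact_mod_cast h.le_q k
  have hqa := h.mul_le_q
  have hq (k : ℕ) : (0 : ℝ) < q k := by exact_mod_cast h.q_pos k
  have hq1 (k : ℕ) : (1 : ℝ) ≤ q k := by exact_mod_cast h.q_pos k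
  refine le_wExp_of_small (C := 1 * (|ζ| + 1) ^ w) fun ε hε => ?_
  obtain ⟨K, hK⟩ := exists_nat_gt (1 / ε)
  obtain ⟨m, hKm, ham⟩ := hlarge K
  have hbound := hζ (m + 1)
  have hεm : 1 / (q (m + 2) : ℝ) < ε := by
    rw [div_lt_comm₀ (hq _) hε]
    have h1 : (K : ℝ) ≤ ((m + 2 : ℕ) : ℝ) := by exact_mod_cast (by omega : K ≤ m + 2)
    exact hK.trans_le (h1.trans (hklt _))
  have hqpos : (0 : ℤ) < (q (m + 1) : ℤ) := by exact_mod_cast h.q_pos _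
  refine ⟨linPoly (q (m + 1)) (p (m + 1)), natDegree_linPoly_le _ _, ?_, ?_, ?_⟩
  · rw [aeval_linPoly]; exact abs_mul_sub_pos hirr hqpos.ne' _
  · rw [aeval_linPoly]; exact lt_of_le_of_lt (by exact_mod_cast hbound) hεm
  · refine abs_linPoly_le (by linarith) hqpos zero_le_one ?_ ?_
    · refine le_trans (by exact_mod_cast hbound) ?_
      rw [div_le_one (hq _)]; exact hq1 _
    · refine le_trans (by exact_mod_cast hbound) ?_
      set Q := (q (m + 1) : ℝ) with hQ
      have hQ0 : 0 < Q := hq _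
      have e1 : Q ^ (w - 1) ≤ a m := by
        have e2 := (Nat.lt_floor_add_one (Q ^ (w - 1))).le
        have e3 : (1 : ℝ) ≤ Nat.log 2 (q (m + 1)) := by
          have : 2 ≤ q (m + 1) := by
            rw [← h.q_one]; exact h.strictMono.monotone (by omega)
          exact_mod_cast Nat.log_pos one_lt_two this
        rw [ham, largeQuotient]
        push_cast
        linarith
      have e4 : Q ^ w ≤ q (m + 2) := by
        calc Q ^ w = Q ^ (w - 1) * Q := by rw [← Real.rpow_add_one hQ0.ne']; ring_nf
          _ ≤ a m * Q := by gcongr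
          _ ≤ _ := hqa m
      rw [one_mul, Int.cast_natCast, Real.rpow_neg hQ0.le, ← one_div]
      exact one_div_le_one_div_of_le (by positivity) e4

/-- Unbounded partial quotients exclude roots of polynomials of degree at most two. -/
lemma aeval_ne_zero (h : IsCF a q p) (hζ : ∀ k, |q k * ζ - p k| ≤ 1 / (q (k + 1) : ℝ))
    (hlarge : ∀ K, ∃ m, K ≤ m ∧ a m = largeQuotient w (q (m + 1))) (P : ℤ[X]) (hP : P ≠ 0)
    (hdeg : P.natDegree ≤ 2) : aeval ζ P ≠ 0 := by
  intro h0
  have hirr := h.irrational hζ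
  have hqa := h.mul_le_q
  have hq (k : ℕ) : (0 : ℝ) < q k := by exact_mod_cast h.q_pos k
  obtain ⟨c, hc, hcl⟩ := exists_pos_le_mul_abs_of_quadratic hirr hP hdeg h0
  obtain ⟨K, hK⟩ := exists_nat_gt (1 / c)
  obtain ⟨m, hKm, ham⟩ := hlarge (2 ^ K)
  have e1 := hcl (q (m + 1)) (p (m + 1)) (by exact_mod_cast h.q_pos _)
  push_cast at e1
  have e2 : K ≤ a m := by
    rw [ham, largeQuotient]
    have : 2 ^ K ≤ q (m + 1) := by
      have := h.le_q (m + 1)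
      omega
    exact (Nat.le_log_of_pow_le one_lt_two this).trans (Nat.le_add_left _ _)
  have e2' : (K : ℝ) ≤ a m := by exact_mod_cast e2
  have e3 : c ≤ q (m + 1) * (1 / q (m + 2)) := by
    refine e1.trans ?_
    have := hq (m + 1)
    gcongr
    exact hζ (m + 1)
  rw [mul_one_div, le_div_iff₀ (hq _)] at e3
  have e4 : 1 < c * K := by rwa [div_lt_iff₀' hc] at hK
  have e5 : (c * K) * q (m + 1) ≤ c * q (m + 2) := by
    rw [mul_assoc]
    have := hq (m + 1)
    have e6 : (K : ℝ) * q (m + 1) ≤ q (m + 2) := le_trans (by gcongr) (hqa m)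
    gcongr
  nlinarith [hq (m + 1)]

/-- Long blocks of partial quotients `1` make the golden polynomials extremely small. -/
lemma wExp_two_eq_top (h : IsCF a q p) (hζ : ∀ k, |q k * ζ - p k| ≤ 1 / (q (k + 1) : ℝ))
    (hnotquad : ∀ P : ℤ[X], P ≠ 0 → P.natDegree ≤ 2 → aeval ζ P ≠ 0)
    (hblock : ∀ K, ∃ s m, K ≤ s ∧ s ≤ m ∧ (∀ i, s ≤ i → i < m → a i = 1) ∧
      q (s + 1) ^ Nat.log 2 (q (s + 1)) ≤ q (m + 1)) : wExp 2 ζ = ⊤ := by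
  have hq (k : ℕ) : (0 : ℝ) < q k := by exact_mod_cast h.q_pos k
  have hq1 (k : ℕ) : (1 : ℝ) ≤ q k := by exact_mod_cast h.q_pos k
  suffices hW : ∀ W : ℝ, 0 ≤ W → (W : EReal) ≤ wExp 2 ζ by
    rw [EReal.eq_top_iff_forall_lt]
    refine fun W => lt_of_lt_of_le (EReal.coe_lt_coe_iff.2 ?_) (hW (|W| + 1) (by positivity))
    linarith [le_abs_self W]
  intro W hW
  refine le_wExp_of_small (C := 3 * 6 ^ W) fun ε hε => ?_
  obtain ⟨K, hK⟩ := exists_nat_gt (max W (3 / ε))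
  have hKW : W ≤ K := (le_max_left _ _).trans hK.le
  have hKε : 3 / ε < K := (le_max_right _ _).trans_lt hK
  obtain ⟨s, m, hKs, hsm, hone, hpow⟩ := hblock (2 ^ K)
  have hval := h.abs_aeval_goldenPoly_le hζ hsm hone
  have hne := h.goldenPoly_ne_zero s
  have hH0 : 0 < height (goldenPoly q p s) := one_pos.trans_le (one_le_height hne)
  refine ⟨goldenPoly q p s, natDegree_quadPoly_le _ _ _,
    abs_pos.2 (hnotquad _ hne (natDegree_quadPoly_le _ _ _)), hval.trans_lt ?_, hval.trans ?_⟩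
  · have e1 : (K : ℝ) ≤ q (m + 1) := by
      have : K ≤ q (m + 1) := by
        have e2 := h.le_q (m + 1)
        have e3 := (Nat.lt_two_pow_self (n := K))
        omega
      exact_mod_cast this
    have e4 : (q (m + 1) : ℝ) ≤ (q (m + 1) : ℝ) ^ 2 := le_self_pow₀ (hq1 _) two_ne_zero
    rw [div_lt_comm₀ (by have := hq (m + 1); positivity) hε]
    linarith
  · set Q := (q (s + 1) : ℝ) with hQ
    have hQ0 : 0 < Q := hq _
    have hQ1 : 1 ≤ Q := hq1 _
    have e1 : Q ^ W ≤ q (m + 1) := by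
      have e2 : K ≤ Nat.log 2 (q (s + 1)) := by
        refine Nat.le_log_of_pow_le one_lt_two ?_
        have := h.le_q (s + 1)
        omega
      have e3 : (Q : ℝ) ^ Nat.log 2 (q (s + 1)) ≤ q (m + 1) := by
        rw [hQ]
        exact_mod_cast hpow
      calc Q ^ W ≤ Q ^ (Nat.log 2 (q (s + 1)) : ℝ) :=
            Real.rpow_le_rpow_of_exponent_le hQ1 (hKW.trans (by exact_mod_cast e2))
        _ ≤ _ := by rwa [Real.rpow_natCast]
    have e4 : height (goldenPoly q p s) ^ W ≤ 6 ^ W * (q (m + 1) : ℝ) ^ 2 := by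
      calc height (goldenPoly q p s) ^ W ≤ (6 * Q ^ 2) ^ W := by
            gcongr; exact h.height_goldenPoly_le s
        _ = 6 ^ W * (Q ^ W) ^ 2 := by
            rw [Real.mul_rpow (by norm_num) (by positivity), ← Real.rpow_natCast,
              ← Real.rpow_natCast, ← Real.rpow_mul hQ0.le, ← Real.rpow_mul hQ0.le, mul_comm W]
        _ ≤ _ := by gcongr
    rw [Real.rpow_neg hH0.le, ← div_eq_mul_inv,
      div_le_div_iff₀ (by have := hq (m + 1); positivity) (by positivity), mul_assoc]
    gcongr

end IsCF

/-- Every `w ≥ 1` is the exponent `w_1` of a `U_2`-number. -/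
lemma exists_isUNumber_two {w : ℝ} (hw : 1 ≤ w) :
    ∃ ζ : ℝ, IsUNumber 2 ζ ∧ wExp 1 ζ = (w : EReal) := by
  obtain ⟨a, q, p, h, hale, hblock⟩ := exists_isCF w
  obtain ⟨ζ, hζ⟩ := h.exists_limit
  have hlarge (K : ℕ) : ∃ m, K ≤ m ∧ a m = largeQuotient w (q (m + 1)) := by
    obtain ⟨s, m, hKs, hsm, -, ham, -⟩ := hblock K
    exact ⟨m, hKs.trans hsm, ham⟩
  have hw1 : wExp 1 ζ = (w : EReal) :=
    le_antisymm (h.wExp_one_le hζ hw hale) (h.le_wExp_one hζ hw hlarge)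
  have hw2 : wExp 2 ζ = ⊤ := h.wExp_two_eq_top hζ (h.aeval_ne_zero hζ hlarge) fun K => by
    obtain ⟨s, m, hKs, hsm, hone, -, hpow⟩ := hblock K
    exact ⟨s, m, hKs, hsm, hone, hpow⟩
  refine ⟨ζ, ⟨transcendental_of_wExp_eq_top hw2, one_le_two, hw2, fun k hk1 hk2 => ?_⟩, hw1⟩
  obtain rfl : k = 1 := by omega
  rw [hw1]
  exact EReal.coe_ne_top _

/-! ### The exponents of `U_2`-numbers and the joint spectrum -/

lemma lambdaExp_of_isUNumber_two {ζ w : ℝ} (h : IsUNumber 2 ζ) (hw : 1 ≤ w)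
    (h1 : wExp 1 ζ = (w : EReal)) {n : ℕ} (hn : 1 ≤ n) :
    lambdaExp n ζ = ((max 1 ((w + 1 - n) / n) : ℝ) : EReal) := by
  have hirr : Irrational ζ := h.1.irrational
  refine le_antisymm (lambdaExp_le_of_wExp_one_eq hirr h1 hn) ?_
  rw [(EReal.coe_strictMono.monotone).map_max, max_le_iff]
  refine ⟨?_, le_lambdaExp_of_wExp_one_eq hw h1 hn⟩
  exact (one_le_lambdaExpMin_two (h1 ▸ EReal.coe_ne_top w) h.2.2.1 hirr hn).trans
    (lambdaExpMin_two_le n ζ)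

lemma one_le_lambda_value_iff {w : ℝ} {n : ℕ} (hn : 1 ≤ n) :
    1 ≤ (w + 1 - n) / n ↔ (n : ℝ) ≤ (w + 1) / 2 := by
  have : (0 : ℝ) < n := by exact_mod_cast hn
  rw [le_div_iff₀ this]
  constructor <;> intro h <;> linarith

lemma modelSeq_eq (w : ℝ) (n : ℕ+) :
    modelSeq w n = ((max 1 ((w + 1 - (n : ℕ)) / (n : ℕ)) : ℝ) : EReal) := by
  have hn : 1 ≤ (n : ℕ) := n.pos
  have hiff : (n : ℕ) ≤ ⌊(w + 1) / 2⌋₊ ↔ 1 ≤ (w + 1 - (n : ℕ)) / (n : ℕ) := by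
    rw [Nat.le_floor_iff' (by omega), one_le_lambda_value_iff hn]
  rw [modelSeq]
  split_ifs with h
  · rw [max_eq_right (hiff.1 h)]
  · rw [max_eq_left (le_of_not_ge fun hcon => h (hiff.2 hcon)), EReal.coe_one]

lemma lambdaSeq_eq_modelSeq {ζ w : ℝ} (h : IsUNumber 2 ζ) (hw : 1 ≤ w)
    (h1 : wExp 1 ζ = (w : EReal)) : lambdaSeq ζ = modelSeq w := by
  funext n
  rw [modelSeq_eq, lambdaSeq, lambdaExp_of_isUNumber_two h hw h1 n.pos]

lemma exists_wExp_one_eq {ζ : ℝ} (hirr : Irrational ζ) (h : wExp 1 ζ ≠ ⊤) :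
    ∃ w : ℝ, 1 ≤ w ∧ wExp 1 ζ = (w : EReal) := by
  have h1 := one_le_wExp_one hirr
  have hbot : wExp 1 ζ ≠ ⊥ := ne_bot_of_le_ne_bot (EReal.coe_ne_bot 1) h1
  refine ⟨(wExp 1 ζ).toReal, ?_, (EReal.coe_toReal h hbot).symm⟩
  rwa [← EReal.coe_toReal h hbot, EReal.coe_le_coe_iff] at h1

lemma exists_modelSeq_eq_of_isUNumber_two {ζ : ℝ} (h : IsUNumber 2 ζ) :
    ∃ w : ℝ, 1 ≤ w ∧ lambdaSeq ζ = modelSeq w := by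
  obtain ⟨w, hw, h1⟩ := exists_wExp_one_eq h.1.irrational (h.2.2.2 1 le_rfl one_lt_two)
  exact ⟨w, hw, lambdaSeq_eq_modelSeq h hw h1⟩

/-- A number all of whose exponents exceed `1/2` is rational, a Liouville number, quadratic, or a
`U_2`-number. -/
lemma lambdaSeq_of_half_lt {ζ : ℝ} (h : ∀ n, ((1 / 2 : ℝ) : EReal) < lambdaSeq ζ n) :
    (∃ w : ℝ, 1 ≤ w ∧ lambdaSeq ζ = modelSeq w) ∨ lambdaSeq ζ = fun _ => ⊤ := by
  by_cases hirr : Irrational ζ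
  swap
  · exact Or.inr (funext fun n => lambdaExp_eq_top_of_not_irrational hirr n)
  by_cases htop : wExp 1 ζ = ⊤
  · exact Or.inr (funext fun n => lambdaExp_eq_top_of_wExp_one_eq_top htop n.pos)
  left
  by_cases hquad : ∀ P : ℤ[X], P ≠ 0 → P.natDegree ≤ 2 → aeval ζ P ≠ 0
  · have h2 := wExp_two_eq_top_of_half_lt hirr hquad fun n hn => h ⟨n, hn⟩
    refine exists_modelSeq_eq_of_isUNumber_two
      ⟨transcendental_of_wExp_eq_top h2, one_le_two, h2, fun k hk1 hk2 => ?_⟩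
    obtain rfl : k = 1 := by omega
    exact htop
  · push Not at hquad
    obtain ⟨P, hP, hdeg, h0⟩ := hquad
    refine ⟨1, le_rfl, funext fun n => ?_⟩
    have hn : (1 : ℝ) ≤ (n : ℕ) := by exact_mod_cast n.pos
    rw [modelSeq_eq, lambdaSeq, lambdaExp_eq_one_of_quadratic hirr hP hdeg h0 n.pos,
      max_eq_left (by rw [div_le_one (by linarith)]; linarith), EReal.coe_one]

lemma half_lt_modelSeq (w : ℝ) (n : ℕ+) : ((1 / 2 : ℝ) : EReal) < modelSeq w n := by
  rw [modelSeq_eq, EReal.coe_lt_coe_iff]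
  exact lt_of_lt_of_le (by norm_num) (le_max_left _ _)

lemma exists_transcendental_lambdaSeq_eq_top :
    ∃ ζ : ℝ, Transcendental ℚ ζ ∧ lambdaSeq ζ = fun _ => ⊤ := by
  have hL : Liouville (liouvilleNumber ((2 : ℕ) : ℝ)) := liouville_liouvilleNumber le_rfl
  set ζ := liouvilleNumber ((2 : ℕ) : ℝ)
  have hirr := hL.irrational
  have h1 : wExp 1 ζ = ⊤ := by
    suffices hW : ∀ W : ℕ, ((W : ℝ) : EReal) ≤ wExp 1 ζ by
      rw [EReal.eq_top_iff_forall_lt]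
      intro W
      obtain ⟨N, hN⟩ := exists_nat_gt W
      exact lt_of_lt_of_le (EReal.coe_lt_coe_iff.2 hN) (hW N)
    intro W
    refine le_wExp_of_small (C := 1 * (|ζ| + 1) ^ (W : ℝ)) fun ε hε => ?_
    obtain ⟨k, hk⟩ := exists_pow_lt_of_lt_one hε (show (1 / 2 : ℝ) < 1 by norm_num)
    obtain ⟨p, q, hq, -, hlt⟩ := hL (W + k + 1)
    have hq2 : (2 : ℝ) ≤ q := by exact_mod_cast hq
    have hq0 : (0 : ℝ) < q := by linarith
    have hle : |q * ζ - p| ≤ 1 / (q : ℝ) ^ (W + k) := by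
      have h2 : q * ζ - p = q * (ζ - p / q) := by field_simp
      rw [h2, abs_mul, abs_of_pos hq0]
      calc (q : ℝ) * |ζ - p / q| ≤ q * (1 / (q : ℝ) ^ (W + k + 1)) := by gcongr
        _ = _ := by rw [pow_succ]; field_simp
    have hqk : 1 / (q : ℝ) ^ (W + k) ≤ (1 / 2) ^ k := by
      rw [one_div_pow]
      refine one_div_le_one_div_of_le (by positivity) ?_
      calc (2 : ℝ) ^ k ≤ q ^ k := by gcongr
        _ ≤ q ^ (W + k) := pow_le_pow_right₀ (by linarith) (by omega)
    have hqW : 1 / (q : ℝ) ^ (W + k) ≤ 1 / (q : ℝ) ^ W :=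
      one_div_le_one_div_of_le (by positivity) (pow_le_pow_right₀ (by linarith) (by omega))
    refine ⟨linPoly q p, natDegree_linPoly_le q p, ?_, ?_, ?_⟩
    · rw [aeval_linPoly]; exact abs_mul_sub_pos hirr (by omega) p
    · rw [aeval_linPoly]; exact (hle.trans hqk).trans_lt hk
    · refine abs_linPoly_le (by positivity) (by omega) zero_le_one
        (hle.trans (hqk.trans (pow_le_one₀ (by norm_num) (by norm_num)))) ?_
      rw [one_mul, Real.rpow_neg hq0.le, Real.rpow_natCast, ← one_div]
      exact hle.trans hqW
  exact ⟨ζ, transcendental_of_wExp_eq_top h1,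
    funext fun n => lambdaExp_eq_top_of_wExp_one_eq_top h1 n.pos⟩

end DiophExp

end

theorem theorem4p1 :
    -- the exponents of a `U_2`-number
    (∀ (ζ w : ℝ), DiophExp.IsUNumber 2 ζ → 1 ≤ w → DiophExp.wExp 1 ζ = (w : EReal) →
      (∀ n : ℕ, 1 ≤ n → (n : ℝ) ≤ (w + 1) / 2 →
        DiophExp.lambdaExp n ζ = (((w + 1 - n) / n : ℝ) : EReal)) ∧
      (∀ n : ℕ, (w + 1) / 2 ≤ (n : ℝ) →
        DiophExp.lambdaExp n ζ = 1 ∧ DiophExp.lambdaExpMin n 2 ζ = 1) ∧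
      (w = 1 → ∀ n : ℕ, 1 ≤ n → DiophExp.lambdaExp n ζ = 1)) ∧
    -- the sequences are precisely those induced by the `U_2`-numbers
    {s : ℕ+ → EReal | ∃ ζ : ℝ, DiophExp.IsUNumber 2 ζ ∧ DiophExp.lambdaSeq ζ = s} =
      {s : ℕ+ → EReal | ∃ w : ℝ, 1 ≤ w ∧ s = DiophExp.modelSeq w} ∧
    -- in particular they belong to the joint spectrum
    (∀ w : ℝ, 1 ≤ w → DiophExp.modelSeq w ∈ DiophExp.jointSpectrum) ∧
    -- together with the constant sequence `∞` they are the part of the joint spectrum above `1/2`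
    {s : ℕ+ → EReal | s ∈ DiophExp.jointSpectrum ∧ ∀ n, ((1 / 2 : ℝ) : EReal) < s n} =
      {s : ℕ+ → EReal | (∃ w : ℝ, 1 ≤ w ∧ s = DiophExp.modelSeq w) ∨ s = fun _ => ⊤} ∧
    -- and this remains so when only transcendental numbers are admitted
    {s : ℕ+ → EReal | (∃ ζ : ℝ, Transcendental ℚ ζ ∧ DiophExp.lambdaSeq ζ = s) ∧
        ∀ n, ((1 / 2 : ℝ) : EReal) < s n} =
      {s : ℕ+ → EReal | (∃ w : ℝ, 1 ≤ w ∧ s = DiophExp.modelSeq w) ∨ s = fun _ => ⊤} := by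
  have hreal : ∀ w : ℝ, 1 ≤ w → ∃ ζ : ℝ, DiophExp.IsUNumber 2 ζ ∧
      DiophExp.lambdaSeq ζ = DiophExp.modelSeq w := by
    intro w hw
    obtain ⟨ζ, hU, h1⟩ := DiophExp.exists_isUNumber_two hw
    exact ⟨ζ, hU, DiophExp.lambdaSeq_eq_modelSeq hU hw h1⟩
  obtain ⟨ξ, hξ, hξtop⟩ := DiophExp.exists_transcendental_lambdaSeq_eq_top
  have hhalf_top : ((1 / 2 : ℝ) : EReal) < ⊤ := EReal.coe_lt_top _
  refine ⟨fun ζ w hU hw h1 => ⟨fun n hn hnw => ?_, fun n hnw => ?_, fun hw1 n hn => ?_⟩,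
    ?_, fun w hw => ?_, ?_, ?_⟩
  · rw [DiophExp.lambdaExp_of_isUNumber_two hU hw h1 hn,
      max_eq_right ((DiophExp.one_le_lambda_value_iff hn).2 hnw)]
  · have hn : 1 ≤ n := by
      have : (1 : ℝ) ≤ n := by linarith
      exact_mod_cast this
    have hn0 : (0 : ℝ) < n := by exact_mod_cast hn
    have hlam : DiophExp.lambdaExp n ζ = 1 := by
      rw [DiophExp.lambdaExp_of_isUNumber_two hU hw h1 hn, max_eq_left, EReal.coe_one]
      rw [div_le_one hn0]; linarith
    refine ⟨hlam, le_antisymm (hlam ▸ DiophExp.lambdaExpMin_two_le n ζ) ?_⟩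
    exact DiophExp.one_le_lambdaExpMin_two (h1 ▸ EReal.coe_ne_top w) hU.2.2.1 hU.1.irrational hn
  · have hn1 : (1 : ℝ) ≤ n := by exact_mod_cast hn
    rw [DiophExp.lambdaExp_of_isUNumber_two hU hw h1 hn, max_eq_left, EReal.coe_one]
    rw [hw1, div_le_one (by linarith)]; linarith
  · ext s
    constructor
    · rintro ⟨ζ, hU, rfl⟩
      exact DiophExp.exists_modelSeq_eq_of_isUNumber_two hU
    · rintro ⟨w, hw, rfl⟩
      exact hreal w hw
  · obtain ⟨ζ, -, h⟩ := hreal w hw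
    exact ⟨ζ, h⟩
  · ext s
    constructor
    · rintro ⟨⟨ζ, rfl⟩, hs⟩
      exact DiophExp.lambdaSeq_of_half_lt hs
    · rintro (⟨w, hw, rfl⟩ | rfl)
      · obtain ⟨ζ, -, h⟩ := hreal w hw
        exact ⟨⟨ζ, h⟩, DiophExp.half_lt_modelSeq w⟩
      · exact ⟨⟨ξ, hξtop⟩, fun _ => hhalf_top⟩
  · ext s
    constructor
    · rintro ⟨⟨ζ, -, rfl⟩, hs⟩
      exact DiophExp.lambdaSeq_of_half_lt hs
    · rintro (⟨w, hw, rfl⟩ | rfl)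
      · obtain ⟨ζ, hU, h⟩ := hreal w hw
        exact ⟨⟨ζ, hU.1, h⟩, DiophExp.half_lt_modelSeq w⟩
      · exact ⟨⟨ξ, hξ, hξtop⟩, fun _ => hhalf_top⟩
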